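/- Let $r\ge 0$ and let $\xi=(\xi_1\ge\dots\ge\xi_r\ge 0)$ be a partition. *The Weyl module.* Let $\mathfrak g_r=\mathfrak{gl}_r\otimes\mathbb C[x,y]$ be the Lie algebra of $r\times r$ matrices over $\mathbb C[x,y]$, with the commutator bracket, and let $E_{ij}$ be the matrix units. Let $W(\xi)$ be the maximal finite-dimensional $\mathfrak g_r$-module generated by a vector $v_\xi$ such that for all $P\in\mathbb C[x,y]$ $$(E_{ii}\otimes P)\,v_\xi=\xi_i\,P(0,0)\,v_\xi\quad(1\le i\le r),\qquad (E_{ij}\otimes P)\,v_\xi=0\quad(1\le i<j\le r),\tag{$*$}$$ that is, $W(\xi)=U(\mathfrak g_r)/I_\xi$, where $I_\xi$ is the smallest left ideal $I$ for which $U(\mathfrak g_r)/I$ is finite-dimensional and the class of $1$ satisfies $(*)$; equivalently, $I_\xi$ is the intersection of all such left ideals. *The degenerated module.* Let $\mathbb C\langle\mathcal X,\mathcal Y\rangle$ be the associative algebra generated by $\mathcal X,\mathcal Y$ with the relation $\mathcal Y\mathcal X-\mathcal X\mathcal Y=\mathcal X$, filtered by $F^n=\mathrm{span}\{\mathcal X^i\mathcal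 Y^j: j\le n\}$, and let $\mathcal G_r=\mathfrak{gl}_r\otimes\mathbb C\langle\mathcal X,\mathcal Y\rangle$ be the Lie algebra of matrices over it, with the induced filtration; then $\mathrm{gr}\,\mathcal G_r\cong\mathfrak g_r$, the class of $E_{ij}\otimes\mathcal X^k\mathcal Y^l$ in $F^l/F^{l-1}$ corresponding to $E_{ij}\otimes x^ky^l$. For $N\in\mathbb Z$ let $\mathcal G_r$ act on $V_r^{(N)}=\mathbb C^r\otimes\left(\mathbb C[x,x^{-1}]/x^N\mathbb C[x]\right)$, with $\mathcal X$ acting as $x$ and $\mathcal Y$ as $x\,\partial/\partial x$, and hence on its exterior powers. Put $u_j^i=u_j\otimes x^i$, where $u_1,\dots,u_r$ is the standard basis of $\mathbb C^r$, let $$v_\xi^{(N)}=\bigwedge_{j=1}^{r}\ \bigwedge_{i=N-\xi_j}^{N-1}u_j^i\ \in\ \bigwedge\nolimits^{|\xi|}V_r^{(N)},$$ and let $\mathcal V(\xi,N)$ be the $\mathcal G_r$-submodule generated by $v_\xi^{(N)}$. Let $U^{\le n}(\mathcal G_r)$ be the filtration of the enveloping algebra induced by that of $\mathcal G_r$, put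 $F^n\mathcal V(\xi,N)=U^{\le n}(\mathcal G_r)\,v_\xi^{(N)}$, and let $V(\xi)=\bigoplus_n F^n\mathcal V(\xi,N)/F^{n-1}\mathcal V(\xi,N)$ be the associated graded $\mathfrak g_r$-module. Its cyclic vector is the class of $v_\xi^{(N)}$ in $F^0\mathcal V(\xi,N)$. (Up to isomorphism $V(\xi)$ does not depend on $N$; the statement below holds for each $N$.) **Proposition.** For every partition $\xi$ and every integer $N$, the cyclic vector of $V(\xi)$ satisfies the relations $(*)$, and there is a canonical surjection of $\mathfrak g_r$-modules $W(\xi)\to V(\xi)$ sending the cyclic vector $v_\xi$ to the cyclic vector of $V(\xi)$; it is the only homomorphism of $\mathfrak g_r$-modules $W(\xi)\to V(\xi)$ with this property. -/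

import Mathlib

attribute [local instance 100] LieRing.ofAssociativeRing

namespace WeylDeg

noncomputable section

open scoped DirectSum

/-! ### The Lie algebra `gl_r ⊗ ℂ[x,y]` and its Weyl modules -/

/-- The polynomial ring `ℂ[x,y]`, with `x = X 0` and `y = X 1`. -/
abbrev Poly2 : Type := MvPolynomial (Fin 2) ℂ

/-- The Lie algebra `𝔤_r = gl_r ⊗ ℂ[x,y]` of `r × r` matrices over `ℂ[x,y]`, with the commutator
bracket. The element `E_{ij} ⊗ P` is `Matrix.single i j P`. -/
abbrev CurrentAlg (r : ℕ) : Type := Matrix (Fin r) (Fin r) Poly2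

/-- The value `P(0,0)`. -/
def evalZero (P : Poly2) : ℂ := MvPolynomial.eval (fun _ => 0) P

/-- The defining relations of a Weyl module for a vector `v` of a `𝔤_r`-module:
`(E_{ii} ⊗ P) v = ξ_i P(0,0) v` for all `i`, and `(E_{ij} ⊗ P) v = 0` for `i < j`. -/
def WeylRel {r : ℕ} (ξ : Fin r → ℂ) {M : Type*} [AddCommGroup M] [Module ℂ M]
    [LieRingModule (CurrentAlg r) M] (v : M) : Prop :=
  (∀ (i : Fin r) (P : Poly2),
      ⁅(Matrix.single i i P : CurrentAlg r), v⁆ = (ξ i * evalZero P) • v) ∧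
  (∀ (i j : Fin r) (P : Poly2), i < j → ⁅(Matrix.single i j P : CurrentAlg r), v⁆ = 0)

/-- The universal enveloping algebra `U(𝔤_r)`. -/
abbrev UCurrent (r : ℕ) : Type := UniversalEnvelopingAlgebra ℂ (CurrentAlg r)

/-- The cyclic `𝔤_r`-module `U(𝔤_r) / I` attached to a left ideal `I`. Every `𝔤_r`-module generated
by one vector is of this form (`I` being the annihilator of the vector). -/
def CyclicMod {r : ℕ} (I : Submodule (UCurrent r) (UCurrent r)) : Type := UCurrent r ⧸ I

namespace CyclicMod

variable {r : ℕ} (I : Submodule (UCurrent r) (UCurrent r))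

instance : AddCommGroup (CyclicMod I) := inferInstanceAs (AddCommGroup (UCurrent r ⧸ I))
instance : Module (UCurrent r) (CyclicMod I) :=
  inferInstanceAs (Module (UCurrent r) (UCurrent r ⧸ I))
instance : Module ℂ (CyclicMod I) := inferInstanceAs (Module ℂ (UCurrent r ⧸ I))
instance : IsScalarTower ℂ (UCurrent r) (CyclicMod I) :=
  inferInstanceAs (IsScalarTower ℂ (UCurrent r) (UCurrent r ⧸ I))

/-- `a ∈ 𝔤_r` acts as the element `a` of `U(𝔤_r)`. -/
instance : LieRingModule (CurrentAlg r) (CyclicMod I) where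
  bracket a m := UniversalEnvelopingAlgebra.ι ℂ a • m
  add_lie a b m := by
    change UniversalEnvelopingAlgebra.ι ℂ (a + b) • m = _
    exact (congrArg (· • m) (map_add _ a b)).trans (add_smul _ _ m)
  lie_add a m n := smul_add _ m n
  leibniz_lie a b m := by
    change UniversalEnvelopingAlgebra.ι ℂ a • UniversalEnvelopingAlgebra.ι ℂ b • m
      = UniversalEnvelopingAlgebra.ι ℂ ⁅a, b⁆ • m
        + UniversalEnvelopingAlgebra.ι ℂ b • UniversalEnvelopingAlgebra.ι ℂ a • m
    rw [LieHom.map_lie, LieRing.of_associative_ring_bracket, sub_smul, mul_smul, mul_smul,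
      sub_add_cancel]

instance : LieModule ℂ (CurrentAlg r) (CyclicMod I) where
  smul_lie c a m := by
    change UniversalEnvelopingAlgebra.ι ℂ (c • a) • m = c • (UniversalEnvelopingAlgebra.ι ℂ a • m)
    rw [map_smul, smul_assoc]
  lie_smul c a m := by
    change UniversalEnvelopingAlgebra.ι ℂ a • (c • m) = c • (UniversalEnvelopingAlgebra.ι ℂ a • m)
    exact smul_algebra_smul_comm c (UniversalEnvelopingAlgebra.ι ℂ a) m

/-- The generator: the class of `1`. -/
def gen : CyclicMod I := Submodule.Quotient.mk (1 : UCurrent r)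

end CyclicMod

/-- The left ideals `I` for which `U(𝔤_r)/I` is a finite-dimensional module whose generator
satisfies the relations `WeylRel ξ`. Up to isomorphism, these `U(𝔤_r)/I` are exactly the
finite-dimensional modules generated by a vector with these relations. -/
def weylIdeals {r : ℕ} (ξ : Fin r → ℂ) : Set (Submodule (UCurrent r) (UCurrent r)) :=
  {I | FiniteDimensional ℂ (CyclicMod I) ∧ WeylRel ξ (CyclicMod.gen I)}

/-- The intersection of all the ideals in `weylIdeals ξ`. -/
def weylIdeal {r : ℕ} (ξ : Fin r → ℂ) : Submodule (UCurrent r) (UCurrent r) :=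
  sInf (weylIdeals ξ)

/-- The Weyl module `W(ξ)`: the maximal finite-dimensional `𝔤_r`-module generated by a vector `v_ξ`
with the relations `WeylRel ξ`. A bigger quotient of `U(𝔤_r)` is one by a smaller left ideal, so
the maximal one is the quotient by the least element of `weylIdeals ξ`, which is the
intersection of this set (see `weylIdeal_eq_of_isLeast`). -/
abbrev WeylModule {r : ℕ} (ξ : Fin r → ℂ) : Type := CyclicMod (weylIdeal ξ)

/-- The cyclic vector `v_ξ` of `W(ξ)`. -/
def WeylModule.cyclicVector {r : ℕ} (ξ : Fin r → ℂ) : WeylModule ξ := CyclicMod.gen (weylIdeal ξ)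

theorem weylIdeal_eq_of_isLeast {r : ℕ} (ξ : Fin r → ℂ) (I : Submodule (UCurrent r) (UCurrent r))
    (h : IsLeast (weylIdeals ξ) I) : weylIdeal ξ = I :=
  h.isGLB.sInf_eq

/-! ### The algebra `ℂ⟨𝒳,𝒴⟩` and the Lie algebra `𝒢_r = gl_r ⊗ ℂ⟨𝒳,𝒴⟩` -/

/-- The relation `𝒴𝒳 - 𝒳𝒴 = 𝒳` between the free generators `𝒳` (index `0`) and `𝒴` (index `1`). -/
inductive DRel : FreeAlgebra ℂ (Fin 2) → FreeAlgebra ℂ (Fin 2) → Prop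
  | comm : DRel (FreeAlgebra.ι ℂ 1 * FreeAlgebra.ι ℂ 0 - FreeAlgebra.ι ℂ 0 * FreeAlgebra.ι ℂ 1)
      (FreeAlgebra.ι ℂ 0)

/-- The associative algebra `ℂ⟨𝒳,𝒴⟩` generated by `𝒳`, `𝒴` with the relation `𝒴𝒳 - 𝒳𝒴 = 𝒳`. -/
abbrev DAlg : Type := RingQuot DRel

/-- The generator `𝒳`. -/
def dX : DAlg := RingQuot.mkAlgHom ℂ DRel (FreeAlgebra.ι ℂ 0)

/-- The generator `𝒴`. -/
def dY : DAlg := RingQuot.mkAlgHom ℂ DRel (FreeAlgebra.ι ℂ 1)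

theorem dY_mul_dX : dY * dX = dX * dY + dX := by
  have h := RingQuot.mkAlgHom_rel ℂ DRel.comm
  simp only [map_sub, map_mul] at h
  have h' : dY * dX - dX * dY = dX := h
  rw [sub_eq_iff_eq_add] at h'
  rw [h', add_comm]

/-- For an increasing filtration `F 0 ⊆ F 1 ⊆ ⋯` of a vector space, the filtration
`n ↦ F (n - 1)`, where `F (-1) = 0`. -/
def prevFilt {M : Type*} [AddCommGroup M] [Module ℂ M] (F : ℕ → Submodule ℂ M) :
    ℕ → Submodule ℂ M
  | 0 => ⊥
  | n + 1 => F n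

/-- `Fⁿ ℂ⟨𝒳,𝒴⟩`: the span of the `𝒳^i 𝒴^j` with `j ≤ n`. -/
def filtD (n : ℕ) : Submodule ℂ DAlg :=
  Submodule.span ℂ {d | ∃ i j : ℕ, j ≤ n ∧ d = dX ^ i * dY ^ j}

/-- The Lie algebra `𝒢_r = gl_r ⊗ ℂ⟨𝒳,𝒴⟩` of `r × r` matrices over `ℂ⟨𝒳,𝒴⟩`, with the commutator
bracket. -/
abbrev DefAlg (r : ℕ) : Type := Matrix (Fin r) (Fin r) DAlg

/-- The degree filtration `Fⁿ 𝒢_r = gl_r ⊗ Fⁿ ℂ⟨𝒳,𝒴⟩`. -/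
def filtG (r n : ℕ) : Submodule ℂ (DefAlg r) where
  carrier := {A | ∀ i j, A i j ∈ filtD n}
  add_mem' := fun hA hB i j => (filtD n).add_mem (hA i j) (hB i j)
  zero_mem' := fun _ _ => (filtD n).zero_mem
  smul_mem' := fun c _ hA i j => (filtD n).smul_mem c (hA i j)

theorem filtD_mono {m n : ℕ} (h : m ≤ n) : filtD m ≤ filtD n := by
  apply Submodule.span_mono
  rintro d ⟨i, j, hj, rfl⟩
  exact ⟨i, j, hj.trans h, rfl⟩

theorem filtG_mono (r : ℕ) {m n : ℕ} (h : m ≤ n) : filtG r m ≤ filtG r n :=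
  fun _ hA i j => filtD_mono h (hA i j)

theorem dX_pow_mul_dY_pow_mem (i j : ℕ) : dX ^ i * dY ^ j ∈ filtD j :=
  Submodule.subset_span ⟨i, j, le_rfl, rfl⟩

theorem prevFilt_le {M : Type*} [AddCommGroup M] [Module ℂ M] {F : ℕ → Submodule ℂ M}
    (hF : ∀ n, F n ≤ F (n + 1)) (n : ℕ) : prevFilt F n ≤ F n := by
  cases n with
  | zero => exact bot_le
  | succ n => exact hF n

theorem dY_mul_dX_pow (c : ℕ) : dY * dX ^ c = dX ^ c * dY + (c : ℂ) • dX ^ c := by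
  induction c with
  | zero => simp
  | succ c ih =>
    rw [pow_succ, ← mul_assoc, ih, add_mul, mul_assoc, dY_mul_dX, mul_add, smul_mul_assoc]
    push_cast
    rw [add_smul, one_smul, ← mul_assoc]
    abel

/-- The product `𝒳^a 𝒴^b · 𝒳^c 𝒴^d` equals `𝒳^{a+c} 𝒴^{b+d}` up to terms of lower degree. -/
theorem monomial_mul_sub_mem (a b c d : ℕ) :
    dX ^ a * dY ^ b * (dX ^ c * dY ^ d) - dX ^ (a + c) * dY ^ (b + d)
      ∈ prevFilt filtD (b + d) := by
  induction b generalizing d with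
  | zero =>
    rw [pow_zero, mul_one, ← mul_assoc, ← pow_add, Nat.zero_add, sub_self]
    exact Submodule.zero_mem _
  | succ b ih =>
    have e : dX ^ a * dY ^ (b + 1) * (dX ^ c * dY ^ d)
        = dX ^ a * dY ^ b * (dX ^ c * dY ^ (d + 1))
          + (c : ℂ) • (dX ^ a * dY ^ b * (dX ^ c * dY ^ d)) := by
      have : dX ^ a * dY ^ (b + 1) * (dX ^ c * dY ^ d)
          = dX ^ a * dY ^ b * (dY * dX ^ c * dY ^ d) := by
        rw [pow_succ]; simp only [mul_assoc]
      rw [this, dY_mul_dX_pow, add_mul, mul_add, smul_mul_assoc, mul_smul_comm, pow_succ']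
      simp only [mul_assoc]
    have h1 := ih (d + 1)
    have h2 : dX ^ a * dY ^ b * (dX ^ c * dY ^ d) ∈ filtD (b + d) := by
      have := (filtD (b + d)).add_mem (prevFilt_le (fun n => filtD_mono n.le_succ) _ (ih d))
        (dX_pow_mul_dY_pow_mem (a + c) (b + d))
      simpa using this
    have e1 : b + 1 + d = b + d + 1 := by omega
    have e2 : b + (d + 1) = b + d + 1 := by omega
    rw [e2] at h1
    rw [e, e1, add_sub_right_comm]
    exact Submodule.add_mem _ h1 (Submodule.smul_mem (filtD (b + d)) _ h2)

/-- The filtration `U^{≤ n}(𝒢_r)` of the enveloping algebra induced by `F^• 𝒢_r`: the span of the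
products `g₁ ⋯ g_k` with `g_s ∈ F^{d_s} 𝒢_r` and `d₁ + ⋯ + d_k ≤ n`. -/
def filtU (r n : ℕ) : Submodule ℂ (UniversalEnvelopingAlgebra ℂ (DefAlg r)) :=
  Submodule.span ℂ {u | ∃ L : List (ℕ × DefAlg r), (∀ p ∈ L, p.2 ∈ filtG r p.1) ∧
    (L.map Prod.fst).sum ≤ n ∧
    u = (L.map fun p => UniversalEnvelopingAlgebra.ι ℂ p.2).prod}

/-! ### Degeneration of a cyclic `𝒢_r`-module into a `𝔤_r`-module -/

section Degeneration

variable {r : ℕ} {M : Type*} [AddCommGroup M] [Module ℂ M] [LieRingModule (DefAlg r) M]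
  [LieModule ℂ (DefAlg r) M]

/-- The action of `U(𝒢_r)` on a `𝒢_r`-module. -/
def uAct (r : ℕ) (M : Type*) [AddCommGroup M] [Module ℂ M] [LieRingModule (DefAlg r) M]
    [LieModule ℂ (DefAlg r) M] :
    UniversalEnvelopingAlgebra ℂ (DefAlg r) →ₐ[ℂ] Module.End ℂ M :=
  UniversalEnvelopingAlgebra.lift ℂ (LieModule.toEnd ℂ (DefAlg r) M)

/-- The filtration `Fⁿ M = U^{≤ n}(𝒢_r) · v`. -/
def filtM (r : ℕ) {M : Type*} [AddCommGroup M] [Module ℂ M] [LieRingModule (DefAlg r) M]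
    [LieModule ℂ (DefAlg r) M] (v : M) (n : ℕ) : Submodule ℂ M :=
  (filtU r n).map ((LinearMap.applyₗ v).comp (uAct r M).toLinearMap)

theorem filtU_mono (r : ℕ) {m n : ℕ} (h : m ≤ n) : filtU r m ≤ filtU r n := by
  apply Submodule.span_mono
  rintro u ⟨L, h1, h2, h3⟩
  exact ⟨L, h1, h2.trans h, h3⟩

theorem filtM_mono (v : M) {m n : ℕ} (h : m ≤ n) : filtM r v m ≤ filtM r v n :=
  Submodule.map_mono (filtU_mono r h)

theorem ι_mul_mem_filtU {l n : ℕ} {g : DefAlg r} (hg : g ∈ filtG r l)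
    {u : UniversalEnvelopingAlgebra ℂ (DefAlg r)} (hu : u ∈ filtU r n) :
    UniversalEnvelopingAlgebra.ι ℂ g * u ∈ filtU r (n + l) := by
  induction hu using Submodule.span_induction with
  | mem u hu =>
    obtain ⟨L, h1, h2, rfl⟩ := hu
    refine Submodule.subset_span ⟨(l, g) :: L, ?_, ?_, ?_⟩
    · intro p hp
      rcases List.mem_cons.1 hp with rfl | hp
      · exact hg
      · exact h1 p hp
    · simp only [List.map_cons, List.sum_cons]; omega
    · simp
  | zero => rw [mul_zero]; exact Submodule.zero_mem _
  | add x y _ _ hx hy => rw [mul_add]; exact Submodule.add_mem _ hx hy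
  | smul c x _ hx => rw [mul_smul_comm]; exact Submodule.smul_mem _ c hx

theorem self_mem_filtM (v : M) : v ∈ filtM r v 0 := by
  refine ⟨1, Submodule.subset_span ⟨[], by simp, by simp, by simp⟩, ?_⟩
  simp

theorem lie_mem_filtM (v : M) {l n : ℕ} {g : DefAlg r} (hg : g ∈ filtG r l) {m : M}
    (hm : m ∈ filtM r v n) : ⁅g, m⁆ ∈ filtM r v (n + l) := by
  obtain ⟨u, hu, rfl⟩ := hm
  refine ⟨UniversalEnvelopingAlgebra.ι ℂ g * u, ι_mul_mem_filtU hg hu, ?_⟩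
  simp [uAct]

theorem lie_mem_prev (v : M) {l n : ℕ} {g : DefAlg r} (hg : g ∈ filtG r l) {m : M}
    (hm : m ∈ prevFilt (filtM r v) n) : ⁅g, m⁆ ∈ prevFilt (filtM r v) (n + l) := by
  cases n with
  | zero =>
    have : m = 0 := by simpa [prevFilt] using hm
    subst this
    rw [lie_zero]
    exact Submodule.zero_mem _
  | succ n =>
    have e : n + 1 + l = n + l + 1 := by omega
    rw [e]
    exact lie_mem_filtM v hg hm

theorem prev_lie_mem_prev (v : M) {l n : ℕ} {g : DefAlg r} (hg : g ∈ prevFilt (filtG r) l) {m : M}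
    (hm : m ∈ filtM r v n) : ⁅g, m⁆ ∈ prevFilt (filtM r v) (n + l) := by
  cases l with
  | zero =>
    have : g = 0 := by simpa [prevFilt] using hg
    subst this
    rw [zero_lie]
    exact Submodule.zero_mem _
  | succ l => exact lie_mem_filtM v hg hm

/-- The graded piece `Fⁿ M / F^{n-1} M`. -/
abbrev GrPiece (r : ℕ) {M : Type*} [AddCommGroup M] [Module ℂ M] [LieRingModule (DefAlg r) M]
    [LieModule ℂ (DefAlg r) M] (v : M) (n : ℕ) : Type _ :=
  (filtM r v n) ⧸ (prevFilt (filtM r v) n).submoduleOf (filtM r v n)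

/-- The degeneration `gr_v M = ⨁ₙ Fⁿ M / F^{n-1} M` of a `𝒢_r`-module `M` with cyclic vector `v`. -/
def Degeneration (r : ℕ) {M : Type*} [AddCommGroup M] [Module ℂ M] [LieRingModule (DefAlg r) M]
    [LieModule ℂ (DefAlg r) M] (v : M) : Type _ :=
  ⨁ n, GrPiece r v n

instance (v : M) : AddCommGroup (Degeneration r v) :=
  inferInstanceAs (AddCommGroup (⨁ n, GrPiece r v n))
instance (v : M) : Module ℂ (Degeneration r v) :=
  inferInstanceAs (Module ℂ (⨁ n, GrPiece r v n))

/-- The class in `Fⁿ M / F^{n-1} M` of an element of `Fⁿ M`, seen in `gr_v M`. -/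
def cls (v : M) (n : ℕ) : filtM r v n →ₗ[ℂ] Degeneration r v :=
  (DirectSum.lof ℂ ℕ (GrPiece r v) n).comp
    (Submodule.mkQ ((prevFilt (filtM r v) n).submoduleOf (filtM r v n)))

/-- The action on `gr_v M` of the class of `g ∈ F^l 𝒢_r` in `F^l 𝒢_r / F^{l-1} 𝒢_r`: it sends the
class of `m` in `Fⁿ M / F^{n-1} M` to the class of `g m` in `F^{n+l} M / F^{n+l-1} M`. -/
def symAct (v : M) (l : ℕ) (g : DefAlg r) (hg : g ∈ filtG r l) :
    Module.End ℂ (Degeneration r v) :=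
  DirectSum.toModule ℂ ℕ (Degeneration r v) fun n =>
    (DirectSum.lof ℂ ℕ (GrPiece r v) (n + l)).comp
      (Submodule.mapQ _ _
        ((LieModule.toEnd ℂ (DefAlg r) M g).restrict (p := filtM r v n) (q := filtM r v (n + l))
          fun _ hm => lie_mem_filtM v hg hm)
        fun _ hm => lie_mem_prev v hg hm)

theorem symAct_cls (v : M) (l : ℕ) (g : DefAlg r) (hg : g ∈ filtG r l) (n : ℕ)
    (m : filtM r v n) :
    symAct v l g hg (cls v n m) = cls v (n + l) ⟨⁅g, (m : M)⁆, lie_mem_filtM v hg m.2⟩ := by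
  unfold symAct cls
  erw [LinearMap.comp_apply, DirectSum.toModule_lof]
  rfl

theorem cls_congr (v : M) {n n' : ℕ} (h : n = n') (m : filtM r v n) (m' : filtM r v n')
    (hm : (m : M) - m' ∈ prevFilt (filtM r v) n) : cls v n m = cls v n' m' := by
  subst h
  exact congrArg (DirectSum.lof ℂ ℕ (GrPiece r v) n) ((Submodule.Quotient.eq _).2 hm)

theorem degeneration_hom_ext (v : M) {f g : Module.End ℂ (Degeneration r v)}
    (h : ∀ n (m : filtM r v n), f (cls v n m) = g (cls v n m)) : f = g := by
  refine DirectSum.linearMap_ext ℂ fun n => Submodule.linearMap_qext _ (LinearMap.ext fun m => ?_)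
  exact h n m

/-- The element `E_{ij} ⊗ 𝒳^k 𝒴^l` of `F^l 𝒢_r`, of which `E_{ij} ⊗ x^k y^l` is the class. -/
def defE {r : ℕ} (i j : Fin r) (k l : ℕ) : DefAlg r := Matrix.single i j (dX ^ k * dY ^ l)

theorem single_mem {i j : Fin r} {l : ℕ} {d : DAlg} (hd : d ∈ filtD l) :
    (Matrix.single i j d : DefAlg r) ∈ filtG r l := by
  intro a b
  rw [Matrix.single_apply]
  split_ifs
  · exact hd
  · exact Submodule.zero_mem _

theorem defE_mem (i j : Fin r) (k l : ℕ) : defE i j k l ∈ filtG r l :=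
  single_mem (dX_pow_mul_dY_pow_mem k l)

/-- The action of `𝔤_r` on `gr_v M`, under the identification of `gr 𝒢_r` with `𝔤_r`: the basis
element `E_{ij} ⊗ x^k y^l` acts as the class of `E_{ij} ⊗ 𝒳^k 𝒴^l` in `F^l 𝒢_r / F^{l-1} 𝒢_r`. -/
def grAct (v : M) : CurrentAlg r →ₗ[ℂ] Module.End ℂ (Degeneration r v) :=
  ∑ i : Fin r, ∑ j : Fin r,
    ((MvPolynomial.basisMonomials (Fin 2) ℂ).constr ℂ fun s =>
        symAct v (s 1) (defE i j (s 0) (s 1)) (defE_mem i j (s 0) (s 1))).comp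
      (Matrix.entryLinearMap ℂ Poly2 i j)

theorem grAct_single (v : M) (i j : Fin r) (s : Fin 2 →₀ ℕ) :
    grAct v (Matrix.single i j (MvPolynomial.monomial s 1)) =
      symAct v (s 1) (defE i j (s 0) (s 1)) (defE_mem i j (s 0) (s 1)) := by
  unfold grAct
  simp only [LinearMap.sum_apply, LinearMap.comp_apply, Matrix.entryLinearMap_apply]
  rw [Finset.sum_eq_single i, Finset.sum_eq_single j]
  · rw [Matrix.single_apply_same]
    have := (MvPolynomial.basisMonomials (Fin 2) ℂ).constr_basis ℂ (fun s =>
      symAct v (s 1) (defE i j (s 0) (s 1)) (defE_mem i j (s 0) (s 1))) s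
    rwa [MvPolynomial.coe_basisMonomials] at this
  · intro b _ hb
    rw [Matrix.single_apply_of_col_ne _ _ (Ne.symm hb), map_zero]
  · simp
  · intro a _ ha
    refine Finset.sum_eq_zero fun b _ => ?_
    rw [Matrix.single_apply_of_row_ne (Ne.symm ha), map_zero]
  · simp

theorem symAct_zero (v : M) (l : ℕ) (h : (0 : DefAlg r) ∈ filtG r l) : symAct v l 0 h = 0 := by
  refine degeneration_hom_ext v fun n m => ?_
  rw [symAct_cls]
  have : (⟨⁅(0 : DefAlg r), (m : M)⁆, lie_mem_filtM v h m.2⟩ : filtM r v (n + l)) = 0 :=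
    Subtype.ext (zero_lie _)
  rw [this, map_zero]
  rfl

theorem symAct_sub (v : M) (l : ℕ) {g h : DefAlg r} (hg : g ∈ filtG r l) (hh : h ∈ filtG r l) :
    symAct v l (g - h) (Submodule.sub_mem _ hg hh) = symAct v l g hg - symAct v l h hh := by
  refine degeneration_hom_ext v fun n m => ?_
  rw [LinearMap.sub_apply, symAct_cls, symAct_cls, symAct_cls, ← map_sub]
  exact congrArg _ (Subtype.ext (sub_lie g h (m : M)))

theorem symAct_comm (v : M) {l l' : ℕ} {g h k : DefAlg r} (hg : g ∈ filtG r l)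
    (hh : h ∈ filtG r l') (hk : k ∈ filtG r (l + l'))
    (hd : ⁅g, h⁆ - k ∈ prevFilt (filtG r) (l + l')) :
    ⁅symAct v l g hg, symAct v l' h hh⁆ = symAct v (l + l') k hk := by
  refine degeneration_hom_ext v fun n m => ?_
  rw [LieRing.of_associative_ring_bracket, LinearMap.sub_apply, Module.End.mul_apply,
    Module.End.mul_apply, symAct_cls, symAct_cls, symAct_cls, symAct_cls, symAct_cls]
  have e : n + l + l' = n + l' + l := by omega
  rw [cls_congr v e ⟨⁅h, ⁅g, (m : M)⁆⁆, _⟩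
      ⟨⁅h, ⁅g, (m : M)⁆⁆, e ▸ lie_mem_filtM v hh (lie_mem_filtM v hg m.2)⟩
      (by rw [sub_self]; exact Submodule.zero_mem _), ← map_sub]
  refine cls_congr v (by omega) _ _ ?_
  have h1 := prev_lie_mem_prev v hd m.2
  have e' : n + l' + l = n + (l + l') := by omega
  have h2 : ∀ {a b : ℕ} {x y : M}, a = b → x = y → y ∈ prevFilt (filtM r v) b →
      x ∈ prevFilt (filtM r v) a := by
    rintro a b x y rfl rfl h
    exact h
  refine h2 e' ?_ h1
  rw [sub_lie, lie_lie]
  rfl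

theorem prevFilt_filtG {l : ℕ} {A : DefAlg r} (h : ∀ i j, A i j ∈ prevFilt filtD l) :
    A ∈ prevFilt (filtG r) l := by
  cases l with
  | zero => exact (Submodule.mem_bot ℂ).2 (Matrix.ext fun i j => (Submodule.mem_bot ℂ).1 (h i j))
  | succ l => exact h

theorem defE_mul_sub_mem (i j p q : Fin r) (k l k' l' : ℕ) :
    defE i j k l * defE p q k' l' - (if j = p then defE i q (k + k') (l + l') else 0)
      ∈ prevFilt (filtG r) (l + l') := by
  unfold defE
  split_ifs with h
  · subst h
    rw [Matrix.single_mul_single_same]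
    refine prevFilt_filtG fun a b => ?_
    have e : (Matrix.single i q (dX ^ k * dY ^ l * (dX ^ k' * dY ^ l')) -
        Matrix.single i q (dX ^ (k + k') * dY ^ (l + l')) : DefAlg r) a b =
        if i = a ∧ q = b then
          dX ^ k * dY ^ l * (dX ^ k' * dY ^ l') - dX ^ (k + k') * dY ^ (l + l') else 0 := by
      rw [Matrix.sub_apply, Matrix.single_apply, Matrix.single_apply]
      split_ifs
      · rfl
      · exact sub_zero _
    rw [e]
    split_ifs
    · exact monomial_mul_sub_mem k l k' l'
    · exact Submodule.zero_mem _
  · rw [Matrix.single_mul_single_of_ne _ _ _ _ h, sub_zero]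
    exact Submodule.zero_mem _

theorem ite_defE_mem (c : Prop) [Decidable c] (i q : Fin r) (k l : ℕ) :
    (if c then defE i q k l else 0) ∈ filtG r l := by
  split_ifs
  · exact defE_mem i q k l
  · exact Submodule.zero_mem _

theorem grAct_ite (v : M) (c : Prop) [Decidable c] (i q : Fin r) (s t : Fin 2 →₀ ℕ) :
    grAct v (if c then Matrix.single i q (MvPolynomial.monomial (s + t) 1) else 0) =
      symAct v (s 1 + t 1) (if c then defE i q (s 0 + t 0) (s 1 + t 1) else 0)
        (ite_defE_mem c i q _ _) := by
  by_cases h : c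
  · simp only [h, if_true]
    exact grAct_single v i q (s + t)
  · simp only [h, if_false, map_zero]
    exact (symAct_zero v _ _).symm

theorem grAct_lie_single (v : M) (i j p q : Fin r) (s t : Fin 2 →₀ ℕ) :
    grAct v ⁅(Matrix.single i j (MvPolynomial.monomial s 1) : CurrentAlg r),
        (Matrix.single p q (MvPolynomial.monomial t 1) : CurrentAlg r)⁆ =
      ⁅grAct v (Matrix.single i j (MvPolynomial.monomial s 1)),
        grAct v (Matrix.single p q (MvPolynomial.monomial t 1))⁆ := by
  have hmul : ∀ (i j p q : Fin r) (s t : Fin 2 →₀ ℕ),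
      (Matrix.single i j (MvPolynomial.monomial s 1) : CurrentAlg r) *
        Matrix.single p q (MvPolynomial.monomial t 1) =
      if j = p then Matrix.single i q (MvPolynomial.monomial (s + t) 1) else 0 := by
    intro i j p q s t
    split_ifs with h
    · subst h
      rw [Matrix.single_mul_single_same, MvPolynomial.monomial_mul, one_mul]
    · exact Matrix.single_mul_single_of_ne _ _ _ _ h _
  rw [LieRing.of_associative_ring_bracket, hmul, hmul, map_sub, add_comm t s, grAct_ite, grAct_ite,
    ← symAct_sub, grAct_single, grAct_single]
  refine (symAct_comm v _ _ _ ?_).symm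
  have h1 := defE_mul_sub_mem i j p q (s 0) (s 1) (t 0) (t 1)
  have h2 := defE_mul_sub_mem p q i j (t 0) (t 1) (s 0) (s 1)
  rw [add_comm (t 1), add_comm (t 0)] at h2
  have h3 := Submodule.sub_mem _ h1 h2
  rw [sub_sub_sub_comm] at h3
  exact h3

theorem current_induction {p : CurrentAlg r → Prop} (h0 : p 0)
    (hadd : ∀ a b, p a → p b → p (a + b)) (hsmul : ∀ (c : ℂ) a, p a → p (c • a))
    (hs : ∀ i j s, p (Matrix.single i j (MvPolynomial.monomial s 1))) (a : CurrentAlg r) : p a := by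
  refine Matrix.induction_on' a h0 hadd fun i j P => ?_
  induction P using MvPolynomial.induction_on' with
  | monomial s c =>
    have := hsmul c _ (hs i j s)
    rw [Matrix.smul_single, MvPolynomial.smul_monomial] at this
    simpa using this
  | add P Q hP hQ =>
    rw [Matrix.single_add]
    exact hadd _ _ hP hQ

theorem grAct_lie (v : M) (a b : CurrentAlg r) : grAct v ⁅a, b⁆ = ⁅grAct v a, grAct v b⁆ := by
  induction a using current_induction with
  | h0 => simp
  | hadd a a' h h' => simp only [add_lie, map_add, h, h']
  | hsmul c a h => simp only [smul_lie, map_smul, h]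
  | hs i j s =>
    induction b using current_induction with
    | h0 => simp
    | hadd a a' h h' => simp only [lie_add, map_add, h, h']
    | hsmul c a h => simp only [lie_smul, map_smul, h]
    | hs p q t => exact grAct_lie_single v i j p q s t

/-- The representation of `𝔤_r` on `gr_v M`. -/
def grRep (v : M) : CurrentAlg r →ₗ⁅ℂ⁆ Module.End ℂ (Degeneration r v) :=
  { grAct v with map_lie' := fun {a b} => grAct_lie v a b }

instance (v : M) : LieRingModule (CurrentAlg r) (Degeneration r v) :=
  LieRingModule.compLieHom (Degeneration r v) (grRep v)

instance (v : M) : LieModule ℂ (CurrentAlg r) (Degeneration r v) :=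
  LieModule.compLieHom (Degeneration r v) (grRep v)

/-- The cyclic vector of `gr_v M`: the class of `v` in `F⁰ M`. -/
def Degeneration.cyclicVector (r : ℕ) {M : Type*} [AddCommGroup M] [Module ℂ M]
    [LieRingModule (DefAlg r) M] [LieModule ℂ (DefAlg r) M] (v : M) : Degeneration r v :=
  cls v 0 ⟨v, self_mem_filtM v⟩

end Degeneration

/-! ### Exterior powers of a representation -/

section Exterior

variable {V : Type*} [AddCommGroup V] [Module ℂ V] {n : ℕ}

/-- The multilinear map `(m_1, …, m_n) ↦ ∑_i m_1 ∧ ⋯ ∧ T m_i ∧ ⋯ ∧ m_n`. -/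
def extDerMulti (n : ℕ) (T : Module.End ℂ V) :
    MultilinearMap ℂ (fun _ : Fin n => V) (⋀[ℂ]^n V) :=
  ∑ i : Fin n, (exteriorPower.ιMulti ℂ n (M := V)).toMultilinearMap.compLinearMap
    (Function.update (fun _ => LinearMap.id) i T)

theorem extDerMulti_apply (T : Module.End ℂ V) (m : Fin n → V) :
    extDerMulti n T m = ∑ i, exteriorPower.ιMulti ℂ n (Function.update m i (T (m i))) := by
  unfold extDerMulti
  rw [sum_apply]
  refine Finset.sum_congr rfl fun i _ => ?_
  rw [MultilinearMap.compLinearMap_apply]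
  refine congrArg (exteriorPower.ιMulti ℂ n) (funext fun k => ?_)
  by_cases h : k = i
  · subst h
    rw [Function.update_self, Function.update_self]
  · rw [Function.update_of_ne h, Function.update_of_ne h]
    rfl

/-- The map `extDerMulti n T` is alternating. -/
def extDerAlt (n : ℕ) (T : Module.End ℂ V) : V [⋀^Fin n]→ₗ[ℂ] (⋀[ℂ]^n V) :=
  { extDerMulti n T with
    map_eq_zero_of_eq' := by
      intro m i j hij hne
      change extDerMulti n T m = 0
      rw [extDerMulti_apply, ← Finset.add_sum_erase _ _ (Finset.mem_univ i),
        ← Finset.add_sum_erase _ _ (Finset.mem_erase.2 ⟨hne.symm, Finset.mem_univ j⟩),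
        Finset.sum_eq_zero, add_zero]
      · have e : Function.update m j (T (m j)) =
            Function.update m i (T (m i)) ∘ Equiv.swap i j := by
          funext k
          by_cases hi : k = i
          · subst hi
            rw [Function.comp_apply, Equiv.swap_apply_left, Function.update_of_ne hne,
              Function.update_of_ne hne.symm, hij]
          · by_cases hj : k = j
            · subst hj
              rw [Function.comp_apply, Equiv.swap_apply_right, Function.update_self,
                Function.update_self, hij]
            · rw [Function.comp_apply, Equiv.swap_apply_of_ne_of_ne hi hj,
                Function.update_of_ne hi, Function.update_of_ne hj]
        rw [e, AlternatingMap.map_swap _ _ hne, add_neg_cancel]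
      · intro k hk
        have hkj : k ≠ j := (Finset.mem_erase.1 hk).1
        have hki : k ≠ i := (Finset.mem_erase.1 (Finset.mem_erase.1 hk).2).1
        refine AlternatingMap.map_eq_zero_of_eq _ _ (i := i) (j := j) ?_ hne
        rw [Function.update_of_ne hki.symm, Function.update_of_ne hkj.symm, hij] }

/-- The action of an endomorphism `T` of `V` on `⋀ⁿ V` (as a Lie algebra element, that is, by the
Leibniz rule): `m_1 ∧ ⋯ ∧ m_n ↦ ∑_i m_1 ∧ ⋯ ∧ T m_i ∧ ⋯ ∧ m_n`. -/
def extDer (n : ℕ) (T : Module.End ℂ V) : Module.End ℂ (⋀[ℂ]^n V) :=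
  exteriorPower.alternatingMapLinearEquiv (extDerAlt n T)

theorem extDer_ιMulti (T : Module.End ℂ V) (m : Fin n → V) :
    extDer n T (exteriorPower.ιMulti ℂ n m) =
      ∑ i, exteriorPower.ιMulti ℂ n (Function.update m i (T (m i))) := by
  unfold extDer
  rw [exteriorPower.alternatingMapLinearEquiv_apply_ιMulti]
  exact extDerMulti_apply T m

theorem end_ext_ιMulti {f g : Module.End ℂ (⋀[ℂ]^n V)}
    (h : ∀ m : Fin n → V, f (exteriorPower.ιMulti ℂ n m) = g (exteriorPower.ιMulti ℂ n m)) :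
    f = g :=
  exteriorPower.linearMap_ext (AlternatingMap.ext h)

theorem extDer_lie (T S : Module.End ℂ V) :
    extDer n ⁅T, S⁆ = ⁅extDer n T, extDer n S⁆ := by
  refine end_ext_ιMulti fun m => ?_
  have key : ∀ T S : Module.End ℂ V, extDer n T (extDer n S (exteriorPower.ιMulti ℂ n m)) =
      ∑ i, ∑ k, exteriorPower.ιMulti ℂ n (Function.update (Function.update m i (S (m i))) k
        (T ((Function.update m i (S (m i))) k))) := by
    intro T S
    rw [extDer_ιMulti, map_sum]
    exact Finset.sum_congr rfl fun i _ => extDer_ιMulti _ _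
  rw [LieRing.of_associative_ring_bracket (extDer n T), LinearMap.sub_apply, Module.End.mul_apply,
    Module.End.mul_apply, key, key, extDer_ιMulti]
  conv_rhs => rw [Finset.sum_comm (f := fun i k => exteriorPower.ιMulti ℂ n
    (Function.update (Function.update m i (T (m i))) k
      (S ((Function.update m i (T (m i))) k))))]
  rw [← Finset.sum_sub_distrib]
  refine Finset.sum_congr rfl fun i _ => ?_
  rw [← Finset.sum_sub_distrib, Finset.sum_eq_single i]
  · rw [Function.update_self, Function.update_self, Function.update_idem, Function.update_idem,
      ← AlternatingMap.map_update_sub]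
    rfl
  · intro k _ hk
    rw [Function.update_of_ne hk, Function.update_of_ne hk.symm, Function.update_comm hk, sub_self]
  · intro h
    exact absurd (Finset.mem_univ i) h

/-- The Lie algebra homomorphism `gl(V) → gl(⋀ⁿ V)`. -/
def extRep (V : Type*) [AddCommGroup V] [Module ℂ V] (n : ℕ) :
    Module.End ℂ V →ₗ⁅ℂ⁆ Module.End ℂ (⋀[ℂ]^n V) where
  toFun := extDer n
  map_add' T S := by
    refine end_ext_ιMulti fun m => ?_
    rw [LinearMap.add_apply, extDer_ιMulti, extDer_ιMulti, extDer_ιMulti,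
      ← Finset.sum_add_distrib]
    exact Finset.sum_congr rfl fun i _ => AlternatingMap.map_update_add _ _ _ _ _
  map_smul' c T := by
    refine end_ext_ιMulti fun m => ?_
    rw [RingHom.id_apply, LinearMap.smul_apply, extDer_ιMulti, extDer_ιMulti, Finset.smul_sum]
    exact Finset.sum_congr rfl fun i _ => AlternatingMap.map_update_smul _ _ _ _ _
  map_lie' := extDer_lie _ _

end Exterior

/-! ### The deformed modules `𝒱(ξ,N)` and their degenerations `V(ξ)` -/

/-- The subspace `x^N ℂ[x]` of `ℂ[x,x⁻¹]`. -/
def tailSub (N : ℤ) : Submodule ℂ (LaurentPolynomial ℂ) :=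
  Submodule.span ℂ {f | ∃ i : ℤ, N ≤ i ∧ f = LaurentPolynomial.T i}

/-- The operator of multiplication by `x` on `ℂ[x,x⁻¹]`. -/
def mulX : Module.End ℂ (LaurentPolynomial ℂ) := LinearMap.mulLeft ℂ (LaurentPolynomial.T 1)

/-- The operator `x ∂/∂x` on `ℂ[x,x⁻¹]`, `x^i ↦ i x^i`. -/
def euler : Module.End ℂ (LaurentPolynomial ℂ) :=
  (AddMonoidAlgebra.basis ℤ ℂ).constr ℂ fun i => (i : ℂ) • LaurentPolynomial.T i

theorem mulX_T (i : ℤ) : mulX (LaurentPolynomial.T i) = LaurentPolynomial.T (i + 1) := by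
  unfold mulX
  rw [LinearMap.mulLeft_apply, ← LaurentPolynomial.T_add, add_comm]

theorem euler_T (i : ℤ) : euler (LaurentPolynomial.T i) = (i : ℂ) • LaurentPolynomial.T i := by
  have h : (LaurentPolynomial.T i : LaurentPolynomial ℂ) = AddMonoidAlgebra.basis ℤ ℂ i :=
    rfl
  unfold euler
  conv_lhs => rw [h]
  rw [Module.Basis.constr_basis]

theorem tailSub_mulX (N : ℤ) : tailSub N ≤ (tailSub N).comap mulX := by
  refine Submodule.span_le.2 ?_
  rintro f ⟨i, hi, rfl⟩
  change mulX (LaurentPolynomial.T i) ∈ tailSub N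
  rw [mulX_T]
  exact Submodule.subset_span ⟨i + 1, by omega, rfl⟩

theorem tailSub_euler (N : ℤ) : tailSub N ≤ (tailSub N).comap euler := by
  refine Submodule.span_le.2 ?_
  rintro f ⟨i, hi, rfl⟩
  change euler (LaurentPolynomial.T i) ∈ tailSub N
  rw [euler_T]
  exact Submodule.smul_mem _ _ (Submodule.subset_span ⟨i, hi, rfl⟩)

/-- The space `ℂ[x,x⁻¹] / x^N ℂ[x]`. -/
abbrev TruncLaurent (N : ℤ) : Type := LaurentPolynomial ℂ ⧸ tailSub N

/-- The class of `x^i` in `ℂ[x,x⁻¹] / x^N ℂ[x]`. -/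
def xPow (N i : ℤ) : TruncLaurent N := Submodule.Quotient.mk (LaurentPolynomial.T i)

/-- The operator induced by `x` on `ℂ[x,x⁻¹] / x^N ℂ[x]`. -/
def truncX (N : ℤ) : Module.End ℂ (TruncLaurent N) := (tailSub N).mapQ _ mulX (tailSub_mulX N)

/-- The operator induced by `x ∂/∂x` on `ℂ[x,x⁻¹] / x^N ℂ[x]`. -/
def truncY (N : ℤ) : Module.End ℂ (TruncLaurent N) := (tailSub N).mapQ _ euler (tailSub_euler N)

theorem truncX_xPow (N i : ℤ) : truncX N (xPow N i) = xPow N (i + 1) :=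
  congrArg Submodule.Quotient.mk (mulX_T i)

theorem truncY_xPow (N i : ℤ) : truncY N (xPow N i) = (i : ℂ) • xPow N i :=
  congrArg Submodule.Quotient.mk (euler_T i)

theorem xPow_eq_zero {N i : ℤ} (h : N ≤ i) : xPow N i = 0 :=
  (Submodule.Quotient.mk_eq_zero _).2 (Submodule.subset_span ⟨i, h, rfl⟩)

theorem trunc_hom_ext {N : ℤ} {E : Type*} [AddCommGroup E] [Module ℂ E]
    {f g : TruncLaurent N →ₗ[ℂ] E} (h : ∀ i, f (xPow N i) = g (xPow N i)) : f = g := by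
  refine Submodule.linearMap_qext _ ((AddMonoidAlgebra.basis ℤ ℂ).ext fun i => ?_)
  have e : AddMonoidAlgebra.basis ℤ ℂ i = (LaurentPolynomial.T i : LaurentPolynomial ℂ) :=
    rfl
  rw [e]
  exact h i

/-- The action of `ℂ⟨𝒳,𝒴⟩` on `ℂ[x,x⁻¹] / x^N ℂ[x]`: `𝒳` acts as `x` and `𝒴` as `x ∂/∂x`. -/
def truncRep (N : ℤ) : DAlg →ₐ[ℂ] Module.End ℂ (TruncLaurent N) :=
  RingQuot.liftAlgHom ℂ ⟨FreeAlgebra.lift ℂ ![truncX N, truncY N], by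
    rintro _ _ ⟨⟩
    simp only [map_sub, map_mul, FreeAlgebra.lift_ι_apply, Matrix.cons_val_zero,
      Matrix.cons_val_one]
    refine trunc_hom_ext fun i => ?_
    rw [LinearMap.sub_apply, Module.End.mul_apply, Module.End.mul_apply, truncX_xPow, truncY_xPow,
      truncY_xPow, map_smul, truncX_xPow, ← sub_smul]
    push_cast
    rw [add_sub_cancel_left, one_smul]⟩

theorem truncRep_dX (N : ℤ) : truncRep N dX = truncX N := by
  simp [truncRep, dX]

theorem truncRep_dY (N : ℤ) : truncRep N dY = truncY N := by
  simp [truncRep, dY]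

/-- The space `V_r^{(N)} = V_r ⊗ (ℂ[x,x⁻¹] / x^N ℂ[x])`, as the space of columns of length `r` with
entries in `ℂ[x,x⁻¹] / x^N ℂ[x]`. -/
abbrev VecMod (r : ℕ) (N : ℤ) : Type := Fin r → TruncLaurent N

/-- The action of `𝒢_r` on `V_r^{(N)}`: a matrix over `ℂ⟨𝒳,𝒴⟩` multiplies a column. -/
def vecRep (r : ℕ) (N : ℤ) : DefAlg r →ₗ⁅ℂ⁆ Module.End ℂ (VecMod r N) where
  toFun A := LinearMap.pi fun i => ∑ j, (truncRep N (A i j)).comp (LinearMap.proj j)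
  map_add' A B := by
    refine LinearMap.ext fun f => funext fun i => ?_
    simp [Finset.sum_add_distrib]
  map_smul' c A := by
    refine LinearMap.ext fun f => funext fun i => ?_
    simp [Finset.smul_sum]
  map_lie' := by
    intro A B
    refine LinearMap.ext fun f => funext fun i => ?_
    have key : ∀ A B : DefAlg r, ∑ j, truncRep N ((A * B) i j) (f j) =
        ∑ j, truncRep N (A i j) (∑ k, truncRep N (B j k) (f k)) := by
      intro A B
      simp only [Matrix.mul_apply, map_sum, map_mul, LinearMap.sum_apply, Module.End.mul_apply]
      exact Finset.sum_comm
    simp only [LieRing.of_associative_ring_bracket, LinearMap.pi_apply, LinearMap.sum_apply,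
      LinearMap.comp_apply, LinearMap.proj_apply, LinearMap.sub_apply, Module.End.mul_apply,
      Pi.sub_apply, Matrix.sub_apply, map_sub, Finset.sum_sub_distrib, key]

/-- The vector `u_j^i = u_j ⊗ x^i` of `V_r^{(N)}`. -/
def uVec {r : ℕ} (N : ℤ) (j : Fin r) (i : ℤ) : VecMod r N := Pi.single j (xPow N i)

/-- The exterior power `⋀ⁿ V_r^{(N)}`. -/
def ExtMod (r : ℕ) (N : ℤ) (n : ℕ) : Type := ⋀[ℂ]^n (VecMod r N)

instance (r : ℕ) (N : ℤ) (n : ℕ) : AddCommGroup (ExtMod r N n) :=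
  inferInstanceAs (AddCommGroup (⋀[ℂ]^n (VecMod r N)))
instance (r : ℕ) (N : ℤ) (n : ℕ) : Module ℂ (ExtMod r N n) :=
  inferInstanceAs (Module ℂ (⋀[ℂ]^n (VecMod r N)))

/-- The representation of `𝒢_r` on `⋀ⁿ V_r^{(N)}`. -/
def extModRep (r : ℕ) (N : ℤ) (n : ℕ) : DefAlg r →ₗ⁅ℂ⁆ Module.End ℂ (ExtMod r N n) :=
  (extRep (VecMod r N) n).comp (vecRep r N)

instance (r : ℕ) (N : ℤ) (n : ℕ) : LieRingModule (DefAlg r) (ExtMod r N n) :=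
  LieRingModule.compLieHom (ExtMod r N n) (extModRep r N n)
instance (r : ℕ) (N : ℤ) (n : ℕ) : LieModule ℂ (DefAlg r) (ExtMod r N n) :=
  LieModule.compLieHom (ExtMod r N n) (extModRep r N n)

/-- The vector `v_ξ^{(N)} = ⋀_{j=1}^r ⋀_{i=N-ξ_j}^{N-1} u_j^i` of `⋀^{|ξ|} V_r^{(N)}`. The factors
are indexed, in this order, by the pairs `(j, t)` with `0 ≤ t < ξ_j`, where `i = N - ξ_j + t`. -/
def wedgeVector {r : ℕ} (ξ : Fin r → ℕ) (N : ℤ) : ExtMod r N (∑ j, ξ j) :=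
  exteriorPower.ιMulti ℂ (∑ j, ξ j) fun k =>
    uVec N (finSigmaFinEquiv.symm k).1
      (N - ξ (finSigmaFinEquiv.symm k).1 + ((finSigmaFinEquiv.symm k).2 : ℕ))

/-- The module `𝒱(ξ,N)`: the `𝒢_r`-submodule of `⋀^{|ξ|} V_r^{(N)}` generated by `v_ξ^{(N)}`. -/
def DeformedWeyl {r : ℕ} (ξ : Fin r → ℕ) (N : ℤ) :
    LieSubmodule ℂ (DefAlg r) (ExtMod r N (∑ j, ξ j)) :=
  LieSubmodule.lieSpan ℂ (DefAlg r) {wedgeVector ξ N}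

/-- The vector `v_ξ^{(N)}` as an element of `𝒱(ξ,N)`. -/
def deformedVector {r : ℕ} (ξ : Fin r → ℕ) (N : ℤ) : DeformedWeyl ξ N :=
  ⟨wedgeVector ξ N, LieSubmodule.subset_lieSpan (Set.mem_singleton _)⟩

/-- The `𝔤_r`-module `V(ξ)`, computed with the integer `N`: the degeneration of `𝒱(ξ,N)` with
respect to the cyclic vector `v_ξ^{(N)}`. -/
abbrev DegenerateWeyl {r : ℕ} (ξ : Fin r → ℕ) (N : ℤ) : Type :=
  Degeneration r (deformedVector ξ N)

/-- The cyclic vector of `V(ξ)`: the class of `v_ξ^{(N)}`. -/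
def DegenerateWeyl.cyclicVector {r : ℕ} (ξ : Fin r → ℕ) (N : ℤ) : DegenerateWeyl ξ N :=
  Degeneration.cyclicVector r (deformedVector ξ N)

end

end WeylDeg

namespace WeylDeg

noncomputable section

open scoped DirectSum

/-! Since `weylIdeal` is an intersection over finite-dimensional quotients, a homomorphism from
$W(\xi)$ to a $\mathfrak g_r$-module $M$ sending $v_\xi$ to $v$ exists as soon as $M$ is
finite-dimensional and $v$ satisfies $(*)$: the annihilator of $v$ is then one of the ideals being
intersected (`exists_weylModule_hom`). A homomorphism out of a cyclic module is determined by the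
image of the generator (`cyclicMod_hom_ext`), which gives uniqueness. Three facts about $V(\xi)$
remain.

Finite dimension: negative powers of $x$ make $V_r^{(N)}$ infinite-dimensional, but $\mathcal X$
raises exponents and $\mathcal Y$ preserves them, so the columns with exponents at least $a$ form a
finite-dimensional submodule. For $a=N-|\xi|$ its exterior power contains $v_\xi^{(N)}$, hence
$\mathcal V(\xi,N)$. A filtration of a finite-dimensional space has a finite-dimensional associated
graded space (`finiteDimensional_degeneration`).

Relations: $E_{ij}\otimes\mathcal X^k\mathcal Y^l$ replaces a factor $u_j^a$ by a multiple of
$u_i^{a+k}$. If $i<j$, or if $i=j$ and $k>0$, this vector is zero or another factor of the wedge,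
because $\xi_j\le\xi_i$; so the wedge is killed (`lie_wedgeVector_eq_zero`). The elements
$E_{ii}\otimes\mathcal Y^l$ act by scalars (`lie_wedgeVector_diag`); for $l=0$ the scalar is
$\xi_i$, and for $l>0$ the result stays in $F^0$, so its class in degree $l$ vanishes
(`weylRel_cyclicVector`).

Surjectivity: $F^n$ is spanned by products of filtered elements applied to $v$, and each such
element acts on the graded module through its symbol in $\mathfrak g_r$, so the graded module is
cyclic (`degeneration_generated`). -/

/-! ### Homomorphisms out of cyclic modules -/

section Cyclic

variable {r : ℕ} {M : Type*} [AddCommGroup M] [Module ℂ M] [LieRingModule (CurrentAlg r) M]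
  [LieModule ℂ (CurrentAlg r) M]

/-- The action of `U(𝔤_r)` on a `𝔤_r`-module. -/
def currentAct (r : ℕ) (M : Type*) [AddCommGroup M] [Module ℂ M] [LieRingModule (CurrentAlg r) M]
    [LieModule ℂ (CurrentAlg r) M] : UCurrent r →ₐ[ℂ] Module.End ℂ M :=
  UniversalEnvelopingAlgebra.lift ℂ (LieModule.toEnd ℂ (CurrentAlg r) M)

@[simp]
theorem currentAct_ι (a : CurrentAlg r) (m : M) :
    currentAct r M (UniversalEnvelopingAlgebra.ι ℂ a) m = ⁅a, m⁆ := by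
  simp [currentAct]

/-- The annihilator in `U(𝔤_r)` of a vector. -/
def annIdeal (v : M) : Submodule (UCurrent r) (UCurrent r) where
  carrier := {u | currentAct r M u v = 0}
  add_mem' {a b} ha hb := by
    change currentAct r M (a + b) v = 0
    rw [map_add, LinearMap.add_apply, show currentAct r M a v = 0 from ha,
      show currentAct r M b v = 0 from hb, add_zero]
  zero_mem' := by
    change currentAct r M 0 v = 0
    rw [map_zero, LinearMap.zero_apply]
  smul_mem' c u hu := by
    change currentAct r M (c * u) v = 0
    rw [map_mul, Module.End.mul_apply, show currentAct r M u v = 0 from hu, map_zero]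

/-- The linear map `U(𝔤_r)/I → M`, `u ↦ u v`, for a left ideal `I` which annihilates `v`. -/
def cyclicLift (v : M) (I : Submodule (UCurrent r) (UCurrent r)) (h : I ≤ annIdeal v) :
    CyclicMod I →ₗ[ℂ] M :=
  ((I.restrictScalars ℂ).liftQ ((LinearMap.applyₗ v).comp (currentAct r M).toLinearMap)
    fun _ hu => h hu).comp (Submodule.Quotient.restrictScalarsEquiv ℂ I).symm.toLinearMap

/-- `cyclicLift` as a homomorphism of `𝔤_r`-modules. -/
def cyclicLiftHom (v : M) (I : Submodule (UCurrent r) (UCurrent r)) (h : I ≤ annIdeal v) :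
    CyclicMod I →ₗ⁅ℂ, CurrentAlg r⁆ M :=
  { cyclicLift v I h with
    map_lie' := by
      intro a m
      obtain ⟨u, rfl⟩ := Submodule.Quotient.mk_surjective I m
      change currentAct r M (UniversalEnvelopingAlgebra.ι ℂ a * u) v = ⁅a, currentAct r M u v⁆
      rw [map_mul, Module.End.mul_apply, currentAct_ι] }

theorem cyclicLiftHom_gen (v : M) (I : Submodule (UCurrent r) (UCurrent r)) (h : I ≤ annIdeal v) :
    cyclicLiftHom v I h (CyclicMod.gen I) = v := by
  change currentAct r M 1 v = v
  rw [map_one, Module.End.one_apply]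

theorem cyclicLift_injective (v : M) :
    Function.Injective (cyclicLift (r := r) v (annIdeal v) le_rfl) := by
  refine (injective_iff_map_eq_zero _).2 fun m hm => ?_
  obtain ⟨u, rfl⟩ := Submodule.Quotient.mk_surjective (annIdeal v) m
  exact (Submodule.Quotient.mk_eq_zero _).2 hm

/-- The quotient $U(\mathfrak g_r)/\mathrm{Ann}(v)$ embeds into $M$ with generator going to $v$, so
both finite dimension and the relations are pulled back along this injection. -/
theorem annIdeal_mem_weylIdeals [FiniteDimensional ℂ M] {ξ : Fin r → ℂ} {v : M}
    (hv : WeylRel ξ v) : annIdeal v ∈ weylIdeals ξ := by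
  have hinj := cyclicLift_injective (r := r) v
  have hlie (a : CurrentAlg r) :
      cyclicLift (r := r) v (annIdeal v) le_rfl ⁅a, CyclicMod.gen (annIdeal v)⁆ = ⁅a, v⁆ := by
    have := (cyclicLiftHom v (annIdeal v) le_rfl).map_lie a (CyclicMod.gen (annIdeal v))
    rwa [cyclicLiftHom_gen] at this
  have hgen : cyclicLift (r := r) v (annIdeal v) le_rfl (CyclicMod.gen (annIdeal v)) = v :=
    cyclicLiftHom_gen v (annIdeal v) le_rfl
  refine ⟨FiniteDimensional.of_injective _ hinj, fun i P => hinj ?_, fun i j P hij => hinj ?_⟩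
  · rw [hlie, hv.1, map_smul, hgen]
  · rw [hlie, hv.2 i j P hij, map_zero]

/-- The universal property of the Weyl module. -/
theorem exists_weylModule_hom [FiniteDimensional ℂ M] {ξ : Fin r → ℂ} {v : M}
    (hv : WeylRel ξ v) :
    ∃ f : WeylModule ξ →ₗ⁅ℂ, CurrentAlg r⁆ M, f (WeylModule.cyclicVector ξ) = v :=
  ⟨cyclicLiftHom v _ (sInf_le (annIdeal_mem_weylIdeals hv)), cyclicLiftHom_gen v _ _⟩

/-- A Lie submodule is stable under all of $U(\mathfrak g_r)$, because the enveloping algebra is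
generated by the Lie algebra; the latter is extracted from the universal property. -/
theorem gen_generates (I : Submodule (UCurrent r) (UCurrent r))
    (S : LieSubmodule ℂ (CurrentAlg r) (CyclicMod I)) (h : CyclicMod.gen I ∈ S) : S = ⊤ := by
  -- The stabilizer of `S`. It contains the image of $\mathfrak g_r$, so `ι` lifts to a map from
  -- $U(\mathfrak g_r)$ to `A`; composed with the inclusion this is the identity by uniqueness of
  -- lifts, so `A` is everything.
  let A : Subalgebra ℂ (UCurrent r) :=
    { carrier := {u | ∀ m ∈ S, u • m ∈ S}
      mul_mem' := fun {a b} ha hb m hm => by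
        rw [mul_smul]
        exact ha _ (hb m hm)
      add_mem' := fun {a b} ha hb m hm => by
        rw [add_smul]
        exact S.add_mem (ha m hm) (hb m hm)
      algebraMap_mem' := fun c m hm => by
        rw [algebraMap_smul]
        exact S.smul_mem c hm }
  let φ : CurrentAlg r →ₗ⁅ℂ⁆ A :=
    { toFun := fun a => ⟨UniversalEnvelopingAlgebra.ι ℂ a, fun _ hm => S.lie_mem hm⟩
      map_add' := fun a b => Subtype.ext (map_add (UniversalEnvelopingAlgebra.ι ℂ) a b)
      map_smul' := fun c a => Subtype.ext (map_smul (UniversalEnvelopingAlgebra.ι ℂ) c a)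
      map_lie' := fun {a b} => Subtype.ext (LieHom.map_lie (UniversalEnvelopingAlgebra.ι ℂ) a b) }
  have hφ : A.val.comp (UniversalEnvelopingAlgebra.lift ℂ φ) = AlgHom.id ℂ (UCurrent r) := by
    refine UniversalEnvelopingAlgebra.hom_ext ℂ (LieHom.ext fun a => ?_)
    change ((UniversalEnvelopingAlgebra.lift ℂ φ (UniversalEnvelopingAlgebra.ι ℂ a) : A) :
      UCurrent r) = UniversalEnvelopingAlgebra.ι ℂ a
    rw [UniversalEnvelopingAlgebra.lift_ι_apply]
    rfl
  refine top_le_iff.1 fun m _ => ?_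
  obtain ⟨u, rfl⟩ := Submodule.Quotient.mk_surjective I m
  have hu : u ∈ A := by
    have := DFunLike.congr_fun hφ u
    change ((UniversalEnvelopingAlgebra.lift ℂ φ u : A) : UCurrent r) = u at this
    exact this ▸ (UniversalEnvelopingAlgebra.lift ℂ φ u).2
  have := hu _ h
  have e : u • CyclicMod.gen I = (Submodule.Quotient.mk u : UCurrent r ⧸ I) := by
    change (Submodule.Quotient.mk (u * 1) : UCurrent r ⧸ I) = _
    rw [mul_one]
  rwa [e] at this

-- The kernel of $f-g$ is a submodule containing the generator.
omit [LieModule ℂ (CurrentAlg r) M] in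
theorem cyclicMod_hom_ext {I : Submodule (UCurrent r) (UCurrent r)}
    {f g : CyclicMod I →ₗ⁅ℂ, CurrentAlg r⁆ M} (h : f (CyclicMod.gen I) = g (CyclicMod.gen I)) :
    f = g := by
  have htop := gen_generates I (f - g).ker (by simp [h])
  refine LieModuleHom.ext fun m => ?_
  have : m ∈ (f - g).ker := htop ▸ LieSubmodule.mem_top m
  simpa [sub_eq_zero] using this

end Cyclic

/-! ### Degenerations -/

section Degeneration

variable {r : ℕ} {M : Type*} [AddCommGroup M] [Module ℂ M] [LieRingModule (DefAlg r) M]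
  [LieModule ℂ (DefAlg r) M]

theorem cls_eq_zero (v : M) {n : ℕ} (m : filtM r v n)
    (hm : (m : M) ∈ prevFilt (filtM r v) n) : cls v n m = 0 := by
  rw [cls_congr v rfl m 0 (by simpa using hm), map_zero]

theorem span_range_cls (v : M) :
    ⨆ n, LinearMap.range (cls v n) = (⊤ : Submodule ℂ (Degeneration r v)) := by
  refine Submodule.eq_top_iff'.2 fun m => ?_
  induction m using DirectSum.induction_on with
  | zero => exact Submodule.zero_mem _
  | of n x =>
    obtain ⟨m, rfl⟩ := Submodule.mkQ_surjective _ x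
    exact Submodule.mem_iSup_of_mem n ⟨m, rfl⟩
  | add x y hx hy => exact Submodule.add_mem _ hx hy

/-- The increasing chain $F^nM$ stabilizes at some $k$, so only the graded pieces of degree at most
$k$ can be nonzero. -/
theorem finiteDimensional_degeneration [FiniteDimensional ℂ M] (v : M) :
    FiniteDimensional ℂ (Degeneration r v) := by
  obtain ⟨k, hk⟩ := (monotone_stabilizes_iff_noetherian (R := ℂ) (M := M)).2 inferInstance
    ⟨filtM r v, fun _ _ h => filtM_mono v h⟩
  have hfin : ⨆ n : Fin (k + 1), LinearMap.range (cls v (n : ℕ)) =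
      (⊤ : Submodule ℂ (Degeneration r v)) := by
    refine top_le_iff.1 ((span_range_cls v).symm.le.trans (iSup_le fun n => ?_))
    rcases lt_or_ge n (k + 1) with hn | hn
    · exact le_iSup (fun n : Fin (k + 1) => LinearMap.range (cls v (n : ℕ))) ⟨n, hn⟩
    -- Here $l\ge k$, so $F^{l+1}=F^k=F^l$ and every class in degree $l+1$ is zero.
    · obtain ⟨l, rfl⟩ : ∃ l, n = l + 1 := ⟨n - 1, by omega⟩
      rintro _ ⟨m, rfl⟩
      have h1 : filtM r v k = filtM r v (l + 1) := hk (l + 1) (by omega)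
      have h2 : filtM r v k = filtM r v l := hk l (by omega)
      rw [cls_eq_zero v m (by change (m : M) ∈ filtM r v l; rw [← h2, h1]; exact m.2)]
      exact Submodule.zero_mem _
  have : FiniteDimensional ℂ (⊤ : Submodule ℂ (Degeneration r v)) := by
    rw [← hfin]
    infer_instance
  exact Module.finite_def.2 (Module.Finite.iff_fg.1 this)

/-! ### Symbols of filtered elements and cyclicity of the graded module -/

theorem lie_eq_grAct (v : M) (a : CurrentAlg r) (x : Degeneration r v) :
    ⁅a, x⁆ = grAct v a x := rfl

theorem symAct_add (v : M) (l : ℕ) {g h : DefAlg r} (hg : g ∈ filtG r l) (hh : h ∈ filtG r l) :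
    symAct v l (g + h) (Submodule.add_mem _ hg hh) = symAct v l g hg + symAct v l h hh := by
  refine degeneration_hom_ext v fun n m => ?_
  rw [LinearMap.add_apply, symAct_cls, symAct_cls, symAct_cls, ← map_add]
  exact congrArg _ (Subtype.ext (add_lie g h (m : M)))

theorem symAct_smul (v : M) (l : ℕ) (c : ℂ) {g : DefAlg r} (hg : g ∈ filtG r l) :
    symAct v l (c • g) (Submodule.smul_mem _ c hg) = c • symAct v l g hg := by
  refine degeneration_hom_ext v fun n m => ?_
  rw [LinearMap.smul_apply, symAct_cls, symAct_cls, ← map_smul]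
  exact congrArg _ (Subtype.ext (smul_lie c g (m : M)))

/-- An element of $F^{l-1}\mathcal G_r$ raises the filtration degree by at most $l-1$, so its class
in degree $l$ acts trivially. -/
theorem symAct_eq_zero (v : M) {l : ℕ} {g : DefAlg r} (hg : g ∈ filtG r l)
    (hg' : g ∈ prevFilt (filtG r) l) : symAct v l g hg = 0 := by
  refine degeneration_hom_ext v fun n m => ?_
  rw [symAct_cls]
  exact cls_eq_zero v _ (prev_lie_mem_prev v hg' m.2)

/-- The class of an element of `F^l 𝒢_r` acts on a degeneration as an element of `𝔤_r`. -/
theorem symAct_mem_range_grAct (v : M) {l : ℕ} {g : DefAlg r} (hg : g ∈ filtG r l) :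
    ∃ a, symAct v l g hg = grAct v a := by
  -- Membership in $F^l\mathcal G_r$ is part of the condition, since `symAct` takes its proof as an
  -- argument. It then suffices to treat the matrices $E_{ij}\otimes\mathcal X^k\mathcal Y^{l'}$
  -- with $l'\le l$.
  let T : Submodule ℂ (DefAlg r) :=
    { carrier := {g | ∃ hg : g ∈ filtG r l, ∃ a, symAct v l g hg = grAct v a}
      zero_mem' := ⟨Submodule.zero_mem _, 0, by rw [symAct_zero, map_zero]⟩
      add_mem' := by
        rintro _ _ ⟨hg, a, ha⟩ ⟨hh, b, hb⟩
        exact ⟨Submodule.add_mem _ hg hh, a + b, by rw [symAct_add v l hg hh, ha, hb, map_add]⟩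
      smul_mem' := by
        rintro c _ ⟨hg, a, ha⟩
        exact ⟨Submodule.smul_mem _ c hg, c • a, by rw [symAct_smul v l c hg, ha, map_smul]⟩ }
  have hsingle (i j : Fin r) : filtD l ≤ T.comap (Matrix.singleLinearMap ℂ i j) := by
    refine Submodule.span_le.2 ?_
    rintro _ ⟨k, l', hl, rfl⟩
    have hmem : defE i j k l' ∈ filtG r l := filtG_mono r hl (defE_mem i j k l')
    refine ⟨hmem, ?_⟩
    -- In top degree the symbol is $E_{ij}\otimes x^ky^l$; in lower degree it is zero.
    rcases hl.eq_or_lt with rfl | hl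
    · refine ⟨Matrix.single i j (MvPolynomial.monomial
        (Finsupp.single 0 k + Finsupp.single 1 l') 1), ?_⟩
      rw [grAct_single]
      simp [defE]
    · refine ⟨0, ?_⟩
      rw [map_zero]
      obtain ⟨n, rfl⟩ : ∃ n, l = n + 1 := ⟨l - 1, by omega⟩
      exact symAct_eq_zero v hmem (filtG_mono r (Nat.lt_succ_iff.1 hl) (defE_mem i j k l'))
  have hT : g ∈ T := by
    rw [Matrix.matrix_eq_sum_single g]
    exact Submodule.sum_mem _ fun i _ => Submodule.sum_mem _ fun j _ => hsingle i j (hg i j)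
  exact hT.2

/-- The degeneration is generated by its cyclic vector. -/
theorem degeneration_generated (v : M) (S : LieSubmodule ℂ (CurrentAlg r) (Degeneration r v))
    (h : Degeneration.cyclicVector r v ∈ S) : S = ⊤ := by
  have hlie {l n : ℕ} {g : DefAlg r} (hg : g ∈ filtG r l) (m : filtM r v n) (hm : cls v n m ∈ S) :
      cls v (n + l) ⟨⁅g, (m : M)⁆, lie_mem_filtM v hg m.2⟩ ∈ S := by
    obtain ⟨a, ha⟩ := symAct_mem_range_grAct v hg
    rw [← symAct_cls v l g hg, ha, ← lie_eq_grAct]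
    exact S.lie_mem hm
  -- A product of filtered elements applied to $v$ has, in the degree equal to the sum of the
  -- individual degrees, a class obtained from that of $v$ by acting successively with symbols. The
  -- degree is a variable with an equation so that the dependent type of `cls` can be rewritten.
  have hlist (L : List (ℕ × DefAlg r)) (hL : ∀ p ∈ L, p.2 ∈ filtG r p.1) :
      ∀ n, n = (L.map Prod.fst).sum →
        ∃ hm : uAct r M (L.map fun p => UniversalEnvelopingAlgebra.ι ℂ p.2).prod v ∈ filtM r v n,
          cls v n ⟨_, hm⟩ ∈ S := by
    induction L with
    | nil =>
      rintro _ rfl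
      have e : uAct r M (([] : List (ℕ × DefAlg r)).map
          fun p => UniversalEnvelopingAlgebra.ι ℂ p.2).prod v = v := by simp
      simp only [e]
      exact ⟨self_mem_filtM v, h⟩
    | cons p L ih =>
      intro n hn
      obtain ⟨hm, hS⟩ := ih (fun q hq => hL q (List.mem_cons_of_mem _ hq)) _ rfl
      have e : uAct r M ((p :: L).map fun p => UniversalEnvelopingAlgebra.ι ℂ p.2).prod v =
          ⁅p.2, uAct r M (L.map fun p => UniversalEnvelopingAlgebra.ι ℂ p.2).prod v⁆ := by
        rw [List.map_cons, List.prod_cons, map_mul, Module.End.mul_apply]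
        simp [uAct]
      rw [List.map_cons, List.sum_cons, add_comm] at hn
      subst hn
      simp only [e]
      exact ⟨lie_mem_filtM v (hL p List.mem_cons_self) hm,
        hlie (hL p List.mem_cons_self) ⟨_, hm⟩ hS⟩
  have hcls (n : ℕ) (m : filtM r v n) : cls v n m ∈ S := by
    obtain ⟨_, u, hu, rfl⟩ := m
    have : ∃ hm : uAct r M u v ∈ filtM r v n, cls v n ⟨_, hm⟩ ∈ S := by
      induction hu using Submodule.span_induction with
      | mem u hu =>
        obtain ⟨L, h1, h2, rfl⟩ := hu
        obtain ⟨hm, hS⟩ := hlist L h1 _ rfl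
        refine ⟨filtM_mono v h2 hm, ?_⟩
        -- A product of total degree less than $n$ already lies in $F^{n-1}$, so its class in degree
        -- $n$ is zero.
        rcases h2.eq_or_lt with rfl | h2
        · exact hS
        · obtain ⟨n, rfl⟩ : ∃ k, n = k + 1 := ⟨n - 1, by omega⟩
          rw [cls_eq_zero v]
          · exact S.zero_mem
          · exact filtM_mono v (Nat.lt_succ_iff.1 h2) hm
      | zero =>
        simp only [map_zero, LinearMap.zero_apply]
        refine ⟨Submodule.zero_mem _, ?_⟩
        rw [cls_eq_zero v _ (Submodule.zero_mem _)]
        exact S.zero_mem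
      | add x y _ _ hx hy =>
        obtain ⟨hx, hx'⟩ := hx
        obtain ⟨hy, hy'⟩ := hy
        simp only [map_add, LinearMap.add_apply]
        refine ⟨Submodule.add_mem _ hx hy, ?_⟩
        have := S.add_mem hx' hy'
        rwa [← map_add] at this
      | smul c x _ hx =>
        obtain ⟨hx, hx'⟩ := hx
        simp only [map_smul, LinearMap.smul_apply]
        refine ⟨Submodule.smul_mem _ c hx, ?_⟩
        have := S.smul_mem c hx'
        rwa [← map_smul] at this
    exact this.2
  refine (LieSubmodule.toSubmodule_eq_top S).1 (top_le_iff.1 ((span_range_cls v).symm.le.trans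
    (iSup_le fun n => ?_)))
  rintro _ ⟨m, rfl⟩
  exact hcls n m

/-- The defining relations of Weyl modules for the cyclic vector of a degeneration, in terms of the
action of `E_{ij} ⊗ 𝒳^k 𝒴^l` on the original vector. -/
theorem weylRel_cyclicVector {v : M} {ξ : Fin r → ℂ}
    (h0 : ∀ i : Fin r, ⁅defE i i 0 0, v⁆ = ξ i • v)
    (hY : ∀ (i : Fin r) (l : ℕ), ∃ c : ℂ, ⁅defE i i 0 l, v⁆ = c • v)
    (hX : ∀ (i : Fin r) (k l : ℕ), ⁅defE i i (k + 1) l, v⁆ = 0)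
    (hlt : ∀ (i j : Fin r) (k l : ℕ), i < j → ⁅defE i j k l, v⁆ = 0) :
    WeylRel ξ (Degeneration.cyclicVector r v) := by
  have key (i j : Fin r) (s : Fin 2 →₀ ℕ) :
      ⁅(Matrix.single i j (MvPolynomial.monomial s 1) : CurrentAlg r),
        Degeneration.cyclicVector r v⁆ =
      cls v (0 + s 1) ⟨⁅defE i j (s 0) (s 1), v⁆,
        lie_mem_filtM v (defE_mem i j _ _) (self_mem_filtM v)⟩ := by
    rw [lie_eq_grAct, grAct_single]
    exact symAct_cls v _ _ _ _ _
  have hsmul (i j : Fin r) (s : Fin 2 →₀ ℕ) (c : ℂ) :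
      (Matrix.single i j (MvPolynomial.monomial s c) : CurrentAlg r) =
        c • Matrix.single i j (MvPolynomial.monomial s 1) := by
    rw [Matrix.smul_single, MvPolynomial.smul_monomial, smul_eq_mul, mul_one]
  refine ⟨fun i P => ?_, fun i j P hij => ?_⟩
  · induction P using MvPolynomial.induction_on' with
    | monomial s c =>
      rw [hsmul, smul_lie, key]
      by_cases hs0 : s 0 = 0
      · by_cases hs1 : s 1 = 0
        · have hs : s = 0 := by
            ext t
            fin_cases t
            · exact hs0
            · exact hs1
          subst hs
          have e : cls v (0 + (0 : Fin 2 →₀ ℕ) 1) ⟨⁅defE i i ((0 : Fin 2 →₀ ℕ) 0)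
              ((0 : Fin 2 →₀ ℕ) 1), v⁆, lie_mem_filtM v (defE_mem i i _ _) (self_mem_filtM v)⟩ =
              ξ i • cls v 0 ⟨v, self_mem_filtM v⟩ := by
            rw [← map_smul]
            exact congrArg (cls v 0) (Subtype.ext (h0 i))
          rw [e, smul_smul, mul_comm]
          simp [evalZero, Degeneration.cyclicVector]
        -- The class is taken in degree $l=s_1>0$, while the vector is a multiple of $v$ and so lies
        -- in $F^0\subseteq F^{l-1}$. The scalar, which is generally nonzero and depends on $N$,
        -- thus disappears in the graded module.
        · obtain ⟨d, hd⟩ := hY i (s 1)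
          rw [cls_eq_zero v, smul_zero]
          · have : MvPolynomial.eval (fun _ => (0 : ℂ)) (MvPolynomial.monomial s c) = 0 := by
              rw [MvPolynomial.eval_monomial, Finsupp.prod, Finset.prod_eq_zero (i := 1),
                mul_zero]
              · simpa using hs1
              · exact zero_pow hs1
            rw [evalZero, this, mul_zero, zero_smul]
          · change ⁅defE i i (s 0) (s 1), v⁆ ∈ _
            obtain ⟨n, hn⟩ : ∃ n, 0 + s 1 = n + 1 := ⟨s 1 - 1, by omega⟩
            rw [hn, hs0, hd]
            exact Submodule.smul_mem _ _ (filtM_mono v (Nat.zero_le n) (self_mem_filtM v))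
      · obtain ⟨k, hk⟩ : ∃ k, s 0 = k + 1 := ⟨s 0 - 1, by omega⟩
        rw [cls_eq_zero v, smul_zero]
        · have : MvPolynomial.eval (fun _ => (0 : ℂ)) (MvPolynomial.monomial s c) = 0 := by
            rw [MvPolynomial.eval_monomial, Finsupp.prod, Finset.prod_eq_zero (i := 0),
              mul_zero]
            · simpa using hs0
            · exact zero_pow hs0
          rw [evalZero, this, mul_zero, zero_smul]
        · change ⁅defE i i (s 0) (s 1), v⁆ ∈ _
          rw [hk, hX]
          exact Submodule.zero_mem _
    | add P Q hP hQ =>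
      rw [Matrix.single_add, add_lie, hP, hQ, ← add_smul, ← mul_add, evalZero, evalZero, evalZero,
        map_add]
  · induction P using MvPolynomial.induction_on' with
    | monomial s c =>
      rw [hsmul, smul_lie, key, cls_eq_zero v, smul_zero]
      change ⁅defE i j (s 0) (s 1), v⁆ ∈ _
      rw [hlt i j _ _ hij]
      exact Submodule.zero_mem _
    | add P Q hP hQ => rw [Matrix.single_add, add_lie, hP, hQ, add_zero]

end Degeneration

/-! ### The modules `𝒱(ξ,N)` are finite-dimensional -/

theorem dAlg_induction {p : DAlg → Prop} (hc : ∀ c : ℂ, p (algebraMap ℂ DAlg c)) (hX : p dX)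
    (hY : p dY) (hmul : ∀ a b, p a → p b → p (a * b)) (hadd : ∀ a b, p a → p b → p (a + b))
    (d : DAlg) : p d := by
  obtain ⟨a, rfl⟩ := RingQuot.mkAlgHom_surjective ℂ DRel d
  induction a using FreeAlgebra.induction with
  | grade0 c => rw [AlgHom.commutes]; exact hc c
  | grade1 x =>
    fin_cases x
    · exact hX
    · exact hY
  | mul a b ha hb => rw [map_mul]; exact hmul _ _ ha hb
  | add a b ha hb => rw [map_add]; exact hadd _ _ ha hb

/-- The span of the classes of the `x^i` with `a ≤ i` in `ℂ[x,x⁻¹] / x^N ℂ[x]`. -/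
def truncFrom (N a : ℤ) : Submodule ℂ (TruncLaurent N) :=
  Submodule.span ℂ {f | ∃ i, a ≤ i ∧ f = xPow N i}

theorem xPow_mem_truncFrom {N a i : ℤ} (h : a ≤ i) : xPow N i ∈ truncFrom N a :=
  Submodule.subset_span ⟨i, h, rfl⟩

/-- Powers with exponent at least $N$ vanish, so the finitely many exponents in $[a,N)$ suffice. -/
instance (N a : ℤ) : FiniteDimensional ℂ (truncFrom N a) := by
  have : truncFrom N a = Submodule.span ℂ (xPow N '' Set.Ico a N) := by
    refine le_antisymm (Submodule.span_le.2 ?_) (Submodule.span_mono ?_)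
    · rintro _ ⟨i, hi, rfl⟩
      rcases lt_or_ge i N with h | h
      · exact Submodule.subset_span ⟨i, ⟨hi, h⟩, rfl⟩
      · rw [xPow_eq_zero h]
        exact Submodule.zero_mem _
    · rintro _ ⟨i, hi, rfl⟩
      exact ⟨i, hi.1, rfl⟩
  rw [this]
  exact FiniteDimensional.span_of_finite ℂ ((Set.finite_Ico a N).image _)

theorem truncRep_mem_truncFrom {N a : ℤ} (d : DAlg) :
    ∀ f ∈ truncFrom N a, truncRep N d f ∈ truncFrom N a := by
  induction d using dAlg_induction with
  | hc c =>
    intro f hf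
    rw [AlgHom.commutes]
    exact Submodule.smul_mem _ c hf
  | hX =>
    refine fun f hf => (Submodule.span_le (p := (truncFrom N a).comap (truncRep N dX))).2 ?_ hf
    rintro _ ⟨i, hi, rfl⟩
    change truncRep N dX (xPow N i) ∈ truncFrom N a
    rw [truncRep_dX, truncX_xPow]
    exact xPow_mem_truncFrom (by omega)
  | hY =>
    refine fun f hf => (Submodule.span_le (p := (truncFrom N a).comap (truncRep N dY))).2 ?_ hf
    rintro _ ⟨i, hi, rfl⟩
    change truncRep N dY (xPow N i) ∈ truncFrom N a
    rw [truncRep_dY, truncY_xPow]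
    exact Submodule.smul_mem _ _ (xPow_mem_truncFrom hi)
  | hmul d e hd he =>
    intro f hf
    rw [map_mul, Module.End.mul_apply]
    exact hd _ (he f hf)
  | hadd d e hd he =>
    intro f hf
    rw [map_add, LinearMap.add_apply]
    exact Submodule.add_mem _ (hd f hf) (he f hf)

/-- The columns with entries in `truncFrom N a`. -/
def vecFrom (r : ℕ) (N a : ℤ) : Submodule ℂ (VecMod r N) :=
  LinearMap.range (LinearMap.pi fun j : Fin r =>
    (truncFrom N a).subtype.comp (LinearMap.proj (φ := fun _ : Fin r => truncFrom N a) j))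

theorem mem_vecFrom {r : ℕ} {N a : ℤ} {f : VecMod r N} :
    f ∈ vecFrom r N a ↔ ∀ j, f j ∈ truncFrom N a :=
  ⟨by rintro ⟨g, rfl⟩ j; exact (g j).2, fun h => ⟨fun j => ⟨f j, h j⟩, rfl⟩⟩

instance (r : ℕ) (N a : ℤ) : FiniteDimensional ℂ (vecFrom r N a) :=
  Module.Finite.range _

theorem vecRep_mem_vecFrom {r : ℕ} {N a : ℤ} (A : DefAlg r) {f : VecMod r N}
    (hf : f ∈ vecFrom r N a) : vecRep r N A f ∈ vecFrom r N a := by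
  refine mem_vecFrom.2 fun i => ?_
  change (∑ j, (truncRep N (A i j)).comp (LinearMap.proj j)) f ∈ _
  rw [LinearMap.sum_apply]
  exact Submodule.sum_mem _ fun j _ => truncRep_mem_truncFrom _ _ (mem_vecFrom.1 hf j)

theorem uVec_mem_vecFrom {r : ℕ} {N a i : ℤ} (j : Fin r) (h : a ≤ i) :
    uVec N j i ∈ vecFrom r N a := by
  refine mem_vecFrom.2 fun k => ?_
  unfold uVec
  by_cases hk : k = j
  · subst hk
    rw [Pi.single_eq_same]
    exact xPow_mem_truncFrom h
  · rw [Pi.single_eq_of_ne hk]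
    exact Submodule.zero_mem _

/-- The image of `⋀ⁿ W` in `⋀ⁿ V` is stable under the endomorphisms of `V` which preserve `W`. -/
theorem extDer_mem_range_map {V : Type*} [AddCommGroup V] [Module ℂ V] {n : ℕ}
    {W : Submodule ℂ V} {T : Module.End ℂ V} (hT : ∀ w ∈ W, T w ∈ W) {x : ⋀[ℂ]^n V}
    (hx : x ∈ LinearMap.range (exteriorPower.map n W.subtype)) :
    extDer n T x ∈ LinearMap.range (exteriorPower.map n W.subtype) := by
  obtain ⟨y, rfl⟩ := hx
  refine ⟨extDer n (T.restrict hT) y, ?_⟩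
  refine LinearMap.congr_fun (f := (exteriorPower.map n W.subtype).comp (extDer n (T.restrict hT)))
    (g := (extDer n T).comp (exteriorPower.map n W.subtype)) ?_ y
  refine exteriorPower.linearMap_ext (AlternatingMap.ext fun m => ?_)
  change exteriorPower.map n W.subtype (extDer n (T.restrict hT) (exteriorPower.ιMulti ℂ n m)) =
    extDer n T (exteriorPower.map n W.subtype (exteriorPower.ιMulti ℂ n m))
  rw [exteriorPower.map_apply_ιMulti, extDer_ιMulti, extDer_ιMulti, map_sum]
  refine Finset.sum_congr rfl fun i _ => ?_
  rw [exteriorPower.map_apply_ιMulti]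
  refine congrArg _ (funext fun k => ?_)
  by_cases hk : k = i
  · subst hk
    simp
  · simp [hk]

theorem lie_extMod {r n : ℕ} {N : ℤ} (A : DefAlg r) (x : ExtMod r N n) :
    ⁅A, x⁆ = extDer n (vecRep r N A) x := rfl

/-- The submodule `⋀ⁿ (vecFrom r N a)` of `⋀ⁿ V_r^{(N)}`. -/
def extFrom (r : ℕ) (N a : ℤ) (n : ℕ) : LieSubmodule ℂ (DefAlg r) (ExtMod r N n) :=
  { toSubmodule := LinearMap.range (exteriorPower.map n (vecFrom r N a).subtype)
    lie_mem := fun {A x} hx => by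
      rw [lie_extMod]
      exact extDer_mem_range_map (fun _ hw => vecRep_mem_vecFrom A hw) hx }

instance (r : ℕ) (N a : ℤ) (n : ℕ) : FiniteDimensional ℂ (extFrom r N a n) :=
  inferInstanceAs (FiniteDimensional ℂ
    (LinearMap.range (exteriorPower.map n (vecFrom r N a).subtype)))

/-- The factor of `v_ξ^{(N)}` with index `(j, t)`. -/
def wedgeFactor {r : ℕ} (ξ : Fin r → ℕ) (N : ℤ) (p : Σ j, Fin (ξ j)) : VecMod r N :=
  uVec N p.1 (N - ξ p.1 + (p.2 : ℕ))

theorem wedgeVector_mem_extFrom {r : ℕ} (ξ : Fin r → ℕ) (N : ℤ) :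
    wedgeVector ξ N ∈ extFrom r N (N - ∑ j, (ξ j : ℤ)) (∑ j, ξ j) := by
  -- The lowest exponent in row $j$ is $N-\xi_j$; replacing $\xi_j$ by $|\xi|$ gives a crude bound
  -- valid for all rows, including the case $r=0$.
  have h (p : Σ j, Fin (ξ j)) : wedgeFactor ξ N p ∈ vecFrom r N (N - ∑ j, (ξ j : ℤ)) := by
    refine uVec_mem_vecFrom _ ?_
    have : (ξ p.1 : ℤ) ≤ ∑ j, (ξ j : ℤ) :=
      Finset.single_le_sum (f := fun j => (ξ j : ℤ)) (fun _ _ => Int.natCast_nonneg _)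
        (Finset.mem_univ _)
    omega
  refine ⟨exteriorPower.ιMulti ℂ _ fun k => ⟨_, h (finSigmaFinEquiv.symm k)⟩, ?_⟩
  exact exteriorPower.map_apply_ιMulti _ _

instance {r : ℕ} (ξ : Fin r → ℕ) (N : ℤ) : FiniteDimensional ℂ (DeformedWeyl ξ N) := by
  have h : DeformedWeyl ξ N ≤ extFrom r N (N - ∑ j, (ξ j : ℤ)) (∑ j, ξ j) :=
    LieSubmodule.lieSpan_le.2 (Set.singleton_subset_iff.2 (wedgeVector_mem_extFrom ξ N))
  have hfin : FiniteDimensional ℂ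
      (extFrom r N (N - ∑ j, (ξ j : ℤ)) (∑ j, ξ j)).toSubmodule :=
    inferInstanceAs (FiniteDimensional ℂ (extFrom r N (N - ∑ j, (ξ j : ℤ)) (∑ j, ξ j)))
  exact Submodule.finiteDimensional_of_le (show (DeformedWeyl ξ N).toSubmodule ≤
    (extFrom r N (N - ∑ j, (ξ j : ℤ)) (∑ j, ξ j)).toSubmodule from h)

/-! ### The action of `E_{ij} ⊗ 𝒳^k 𝒴^l` on `v_ξ^{(N)}` -/

theorem truncRep_monomial_xPow (N i : ℤ) (k l : ℕ) :
    truncRep N (dX ^ k * dY ^ l) (xPow N i) = ((i : ℂ) ^ l) • xPow N (i + k) := by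
  have hY : (truncY N ^ l) (xPow N i) = ((i : ℂ) ^ l) • xPow N i := by
    induction l with
    | zero => simp
    | succ l ih =>
      rw [pow_succ', Module.End.mul_apply, ih, map_smul, truncY_xPow, smul_smul, pow_succ]
  have hX : (truncX N ^ k) (xPow N i) = xPow N (i + k) := by
    induction k with
    | zero => simp
    | succ k ih =>
      rw [pow_succ', Module.End.mul_apply, ih, truncX_xPow]
      push_cast
      rw [add_assoc]
  rw [map_mul, map_pow, map_pow, truncRep_dX, truncRep_dY, Module.End.mul_apply, hY, map_smul, hX]

theorem vecRep_single {r : ℕ} (N : ℤ) (i j : Fin r) (d : DAlg) (f : VecMod r N) :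
    vecRep r N (Matrix.single i j d) f = Pi.single i (truncRep N d (f j)) := by
  funext a
  change (∑ b, (truncRep N ((Matrix.single i j d : DefAlg r) a b)).comp (LinearMap.proj b)) f = _
  rw [LinearMap.sum_apply]
  simp only [LinearMap.comp_apply, LinearMap.proj_apply]
  by_cases ha : a = i
  · subst ha
    rw [Finset.sum_eq_single j, Matrix.single_apply_same, Pi.single_eq_same]
    · intro b _ hb
      rw [Matrix.single_apply_of_col_ne _ _ (Ne.symm hb), map_zero, LinearMap.zero_apply]
    · simp
  · rw [Pi.single_eq_of_ne ha]
    refine Finset.sum_eq_zero fun b _ => ?_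
    rw [Matrix.single_apply_of_row_ne (Ne.symm ha), map_zero, LinearMap.zero_apply]

theorem vecRep_defE_uVec {r : ℕ} (N : ℤ) (i j : Fin r) (k l : ℕ) (p : Fin r) (a : ℤ) :
    vecRep r N (defE i j k l) (uVec N p a) =
      if p = j then ((a : ℂ) ^ l) • uVec N i (a + k) else 0 := by
  unfold defE uVec
  rw [vecRep_single]
  split_ifs with h
  · subst h
    rw [Pi.single_eq_same, truncRep_monomial_xPow, Pi.single_smul]
  · rw [Pi.single_eq_of_ne (Ne.symm h), map_zero, Pi.single_zero]

theorem uVec_eq_zero {r : ℕ} {N i : ℤ} (j : Fin r) (h : N ≤ i) : uVec N j i = 0 := by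
  unfold uVec
  rw [xPow_eq_zero h, Pi.single_zero]

/-- In each Leibniz term one factor becomes zero or proportional to another factor, so the term
vanishes by alternation. -/
theorem extDer_ιMulti_eq_zero {V : Type*} [AddCommGroup V] [Module ℂ V] {n : ℕ}
    {T : Module.End ℂ V} {m : Fin n → V}
    (h : ∀ s, T (m s) = 0 ∨ ∃ (c : ℂ) (t : Fin n), s ≠ t ∧ T (m s) = c • m t) :
    extDer n T (exteriorPower.ιMulti ℂ n m) = 0 := by
  rw [extDer_ιMulti]
  refine Finset.sum_eq_zero fun s _ => ?_
  rcases h s with h | ⟨c, t, hst, h⟩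
  · rw [h]
    exact AlternatingMap.map_update_zero _ _ _
  · rw [h, AlternatingMap.map_update_smul, AlternatingMap.map_update_self _ _ hst, smul_zero]

theorem extDer_ιMulti_eigen {V : Type*} [AddCommGroup V] [Module ℂ V] {n : ℕ}
    {T : Module.End ℂ V} {m : Fin n → V} {c : Fin n → ℂ} (h : ∀ s, T (m s) = c s • m s) :
    extDer n T (exteriorPower.ιMulti ℂ n m) = (∑ s, c s) • exteriorPower.ιMulti ℂ n m := by
  rw [extDer_ιMulti, Finset.sum_smul]
  refine Finset.sum_congr rfl fun s _ => ?_
  rw [h, AlternatingMap.map_update_smul, Function.update_eq_self]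

/-- Row $i$ of the wedge holds every exponent from $N-\xi_i$ to $N-1$. A factor of row $j$ has
exponent at least $N-\xi_j\ge N-\xi_i$, so after moving to row $i$ and being raised by $k$ it either
repeats a factor or has exponent at least $N$ and is zero. -/
theorem lie_wedgeVector_eq_zero {r : ℕ} {ξ : Fin r → ℕ} (N : ℤ) {i j : Fin r} {k : ℕ}
    (hξ : ξ j ≤ ξ i) (hne : i ≠ j ∨ k ≠ 0) (l : ℕ) :
    ⁅defE i j k l, wedgeVector ξ N⁆ = 0 := by
  refine extDer_ιMulti_eq_zero (T := vecRep r N (defE i j k l))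
    (m := fun s => wedgeFactor ξ N (finSigmaFinEquiv.symm s)) fun s => ?_
  obtain ⟨⟨p, a⟩, rfl⟩ := finSigmaFinEquiv.surjective s
  have hact : vecRep r N (defE i j k l) (wedgeFactor ξ N ⟨p, a⟩) = _ :=
    vecRep_defE_uVec N i j k l p _
  simp only [Equiv.symm_apply_apply, hact]
  split_ifs with hp
  · subst hp
    rcases lt_or_ge ((a : ℕ) + k) (ξ p) with h | h
    -- The position in row $i$ comes from $N-\xi_p+a+k=N-\xi_i+(a+k+(\xi_i-\xi_p))$; the
    -- natural-number subtraction is exact because $\xi_p\le\xi_i$.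
    · refine Or.inr ⟨((N - ξ p + (a : ℕ) : ℤ) : ℂ) ^ l,
        finSigmaFinEquiv ⟨i, ⟨a + k + (ξ i - ξ p), by omega⟩⟩, ?_, ?_⟩
      -- If the two positions agree, the rows agree and then $a=a+k$, contradicting `hne`.
      · intro he
        have he := finSigmaFinEquiv.injective he
        obtain rfl : p = i := congrArg Sigma.fst he
        have h2 : (a : ℕ) = a + k + (ξ p - ξ p) := by
          have := eq_of_heq (Sigma.mk.inj he).2
          exact congrArg Fin.val this
        rcases hne with hne | hne
        · exact hne rfl
        · omega
      · rw [Equiv.symm_apply_apply]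
        refine congrArg _ (congrArg (uVec N i) ?_)
        push_cast [Nat.cast_sub hξ]
        ring
    · left
      rw [uVec_eq_zero _ (by omega), smul_zero]
  · exact Or.inl rfl

/-- Every factor is an eigenvector, with eigenvalue the $l$-th power of its exponent in row $i$ and
zero in the other rows; on the wedge the eigenvalues add up. -/
theorem lie_wedgeVector_diag {r : ℕ} (ξ : Fin r → ℕ) (N : ℤ) (i : Fin r) (l : ℕ) :
    ⁅defE i i 0 l, wedgeVector ξ N⁆ =
      (∑ a : Fin (ξ i), (((N - ξ i + (a : ℕ) : ℤ) : ℂ) ^ l)) • wedgeVector ξ N := by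
  let c (p : Σ j, Fin (ξ j)) : ℂ :=
    if p.1 = i then ((N - ξ p.1 + (p.2 : ℕ) : ℤ) : ℂ) ^ l else 0
  have hact (p : Σ j, Fin (ξ j)) :
      vecRep r N (defE i i 0 l) (wedgeFactor ξ N p) = c p • wedgeFactor ξ N p := by
    obtain ⟨p, a⟩ := p
    refine (vecRep_defE_uVec N i i 0 l p _).trans ?_
    simp only [c, wedgeFactor]
    split_ifs with hp
    · subst hp
      rw [Nat.cast_zero, add_zero]
    · rw [zero_smul]
  have hsum : ∑ k, c (finSigmaFinEquiv.symm k) =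
      ∑ a : Fin (ξ i), (((N - ξ i + (a : ℕ) : ℤ) : ℂ) ^ l) := by
    rw [Equiv.sum_comp finSigmaFinEquiv.symm c, Fintype.sum_sigma, Finset.sum_eq_single i]
    · simp [c]
    · intro p _ hp
      simp [c, hp]
    · simp
  rw [← hsum]
  exact extDer_ιMulti_eigen fun s => hact (finSigmaFinEquiv.symm s)

theorem weylRel_degenerateWeyl {r : ℕ} {ξ : Fin r → ℕ} (hξ : Antitone ξ) (N : ℤ) :
    WeylRel (fun i => (ξ i : ℂ)) (DegenerateWeyl.cyclicVector ξ N) := by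
  refine weylRel_cyclicVector (fun i => Subtype.ext ?_) (fun i l => ?_)
    (fun i k l => Subtype.ext ?_) fun i j k l hij => Subtype.ext ?_
  -- For $l=0$ each of the $\xi_i$ summands is $1$, also when the exponent is zero, because $0^0=1$.
  · refine (lie_wedgeVector_diag ξ N i 0).trans ?_
    simp [deformedVector]
  · exact ⟨_, Subtype.ext (lie_wedgeVector_diag ξ N i l)⟩
  · exact lie_wedgeVector_eq_zero N le_rfl (Or.inr k.succ_ne_zero) l
  · exact lie_wedgeVector_eq_zero N (hξ hij.le) (Or.inl hij.ne) l

end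

end WeylDeg

theorem mainTheorem9 (r : ℕ) (ξ : Fin r → ℕ) (hξ : Antitone ξ) (N : ℤ) :
    WeylDeg.WeylRel (fun i => (ξ i : ℂ)) (WeylDeg.DegenerateWeyl.cyclicVector ξ N) ∧
    ∃ f : WeylDeg.WeylModule (fun i => (ξ i : ℂ)) →ₗ⁅ℂ, WeylDeg.CurrentAlg r⁆
        WeylDeg.DegenerateWeyl ξ N,
      f (WeylDeg.WeylModule.cyclicVector fun i => (ξ i : ℂ)) =
          WeylDeg.DegenerateWeyl.cyclicVector ξ N ∧
      Function.Surjective f ∧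
      ∀ f' : WeylDeg.WeylModule (fun i => (ξ i : ℂ)) →ₗ⁅ℂ, WeylDeg.CurrentAlg r⁆
          WeylDeg.DegenerateWeyl ξ N,
        f' (WeylDeg.WeylModule.cyclicVector fun i => (ξ i : ℂ)) =
          WeylDeg.DegenerateWeyl.cyclicVector ξ N → f' = f := by
  have := WeylDeg.finiteDimensional_degeneration (r := r) (WeylDeg.deformedVector ξ N)
  have hrel := WeylDeg.weylRel_degenerateWeyl hξ N
  obtain ⟨f, hf⟩ := WeylDeg.exists_weylModule_hom hrel
  refine ⟨hrel, f, hf, ?_, fun f' hf' => WeylDeg.cyclicMod_hom_ext (hf'.trans hf.symm)⟩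
  -- The range is a submodule containing the cyclic vector of $V(\xi)$.
  exact (LieModuleHom.range_eq_top f).1
    (WeylDeg.degeneration_generated _ f.range ⟨WeylDeg.WeylModule.cyclicVector _, hf⟩)
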